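/- Let $L^{2,o}(\mathbb T^2)$ be the complex Hilbert space of square-integrable odd functions on $\mathbb T^2=(\mathbb R/2\pi\mathbb Z)^2\equiv[-\pi,\pi)^2$. For $\lambda,\mu\in\mathbb R$ let $H_{\lambda\mu}(0)=H_0(0)+V_{\lambda\mu}$ on $L^{2,o}(\mathbb T^2)$, where $H_0(0)$ is multiplication by $\mathcal E_0(p)=2\sum_{i=1}^2(1-\cos p_i)$ and $$[V_{\lambda\mu}f](s)=\frac1{(2\pi)^2}\int_{\mathbb T^2}v_{\lambda\mu}(s-t)f(t)\,dt,\qquad v_{\lambda\mu}(p)=\lambda\sum_{i=1}^2\cos p_i+\mu\sum_{i=1}^2\cos 2p_i+4\mu\cos p_1\cos p_2,$$ that is, $$[V_{\lambda\mu}f](s)=\frac{\lambda}{4\pi^2}\sum_{i}\sin s_i\int\sin t_i\,f(t)\,dt+\frac{\mu}{4\pi^2}\sum_i\sin 2s_i\int\sin 2t_i\,f(t)\,dt+\frac{\mu}{\pi^2}\sum_{i\ne j}\sin s_i\cos s_j\int\sin t_i\cos t_j\,f(t)\,dt .$$ Put $$\mu_0^{\pm}=\frac{88-30\pi\pm\sqrt{1044\pi^2-6720\pi+10816}}{240\pi-24\pi^2-512}\,\pi,$$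 $$\mu_1^{\pm}=\frac{128-16\pi-9\pi^2\pm\sqrt{225\pi^4-1440\pi^3+3904\pi^2-10240\pi+16384}}{120\pi-12\pi^2-256},$$ $$C^{\pm}(\lambda,\mu)=\frac{30\pi-3\pi^2-64}{6\pi^2}\Big[8(\mu\pm\mu_0^+)(\mu\pm\mu_0^-)\mp\lambda(\mu\pm\mu_1^+)(\mu\pm\mu_1^-)\Big],$$ $$g^{\pm}(\mu)=\pm\frac{8(\mu\pm\mu_0^+)(\mu\pm\mu_0^-)}{(\mu\pm\mu_1^+)(\mu\pm\mu_1^-)},$$ and define subsets of the $(\lambda,\mu)$-plane by $$\mathcal C_0^-=\{\lambda>g^-(\mu),\ \mu>\mu_1^+\},\qquad \mathcal C_3^-=\{\lambda<g^-(\mu),\ \mu<\mu_1^-\},$$ $$\mathcal C_1^-=\{\lambda<g^-(\mu),\ \mu>\mu_1^+\}\cup\{\mu=\mu_1^+\}\cup\{\lambda>g^-(\mu),\ \mu_1^-<\mu<\mu_1^+\},$$ $$\mathcal C_2^-=\{\lambda<g^-(\mu),\ \mu_1^-<\mu<\mu_1^+\}\cup\{\mu=\mu_1^-\}\cup\{\lambda>g^-(\mu),\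 \mu<\mu_1^-\},$$ $$\mathcal C_0^+=\{\lambda<g^+(\mu),\ \mu<-\mu_1^+\},\qquad \mathcal C_3^+=\{\lambda>g^+(\mu),\ \mu>-\mu_1^-\},$$ $$\mathcal C_1^+=\{\lambda>g^+(\mu),\ \mu<-\mu_1^+\}\cup\{\mu=-\mu_1^+\}\cup\{\lambda<g^+(\mu),\ -\mu_1^+<\mu<-\mu_1^-\},$$ $$\mathcal C_2^+=\{\lambda>g^+(\mu),\ -\mu_1^+<\mu<-\mu_1^-\}\cup\{\mu=-\mu_1^-\}\cup\{\lambda<g^+(\mu),\ \mu>-\mu_1^-\}.$$ **Theorem.** For all $\lambda,\mu\in\mathbb R$ the essential spectrum of $H_{\lambda\mu}(0)$ is $[0,8]$. The sets $\mathcal C_k^-$ (respectively $\mathcal C_k^+$), $k=0,1,2,3$, are distinct and are exactly the connected components of $\{(\lambda,\mu):C^-(\lambda,\mu)\neq0\}$ (respectively of $\{(\lambda,\mu):C^+(\lambda,\mu)\ne0\}$). For each $k\in\{0,1,2,3\}$, the number of eigenvalues of $H_{\lambda\mu}(0)$ below its essential spectrum, counted with multiplicity, is finite and constant for $(\lambda,\mu)\in\mathcal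 C_k^-$; and the number of eigenvalues of $H_{\lambda\mu}(0)$ above its essential spectrum, counted with multiplicity, is finite and constant for $(\lambda,\mu)\in\mathcal C_k^+$. -/

import Mathlib

open MeasureTheory

noncomputable section

namespace TwoFermion

/-! ## The Hilbert space of odd functions on the torus -/

/-- Lebesgue measure on the square `[-π, π)²`, which represents the torus `𝕋² = (ℝ/2πℤ)²`
with its Haar measure `dp` (of total mass `4π²`). -/
def torus : Measure (ℝ × ℝ) :=
  volume.restrict (Set.Ico (-Real.pi) Real.pi ×ˢ Set.Ico (-Real.pi) Real.pi)

instance : IsFiniteMeasure torus := by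
  refine ⟨?_⟩
  rw [torus, Measure.restrict_apply_univ, Measure.volume_eq_prod, Measure.prod_prod]
  simp only [Real.volume_Ico]
  exact ENNReal.mul_lt_top ENNReal.ofReal_lt_top ENNReal.ofReal_lt_top

theorem quasiMeasurePreserving_neg :
    Measure.QuasiMeasurePreserving (fun p : ℝ × ℝ => -p) torus torus := by
  refine ⟨measurable_neg, ?_⟩
  have h1 : torus = volume.restrict
      (Set.Icc (-Real.pi) Real.pi ×ˢ Set.Icc (-Real.pi) Real.pi) := by
    rw [torus, Measure.volume_eq_prod, ← Measure.prod_restrict, ← Measure.prod_restrict,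
      Measure.restrict_congr_set Ico_ae_eq_Icc]
  have h2 : Measure.map (fun p : ℝ × ℝ => -p) torus = torus := by
    have hv : MeasurePreserving (fun p : ℝ × ℝ => -p) volume volume :=
      Measure.measurePreserving_neg _
    have hs : (fun p : ℝ × ℝ => -p) ⁻¹'
        (Set.Icc (-Real.pi) Real.pi ×ˢ Set.Icc (-Real.pi) Real.pi) =
        Set.Icc (-Real.pi) Real.pi ×ˢ Set.Icc (-Real.pi) Real.pi := by
      ext p
      simp only [Set.mem_preimage, Set.mem_prod, Set.mem_Icc, Prod.fst_neg, Prod.snd_neg]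
      constructor <;> rintro ⟨⟨_, _⟩, _, _⟩ <;>
        exact ⟨⟨by linarith, by linarith⟩, by linarith, by linarith⟩
    have := hv.restrict_preimage (measurableSet_Icc.prod measurableSet_Icc :
      MeasurableSet (Set.Icc (-Real.pi) Real.pi ×ˢ Set.Icc (-Real.pi) Real.pi))
    rw [hs, ← h1] at this
    exact this.map_eq
  rw [h2]

/-- `L^{2,o}(𝕋²)`: the (complex) Hilbert space of square-integrable odd functions. -/
def oddL2 : Submodule ℂ (Lp ℂ 2 torus) where
  carrier := {f | ∀ᵐ p ∂torus, f (-p) = -f p}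
  add_mem' {f g} hf hg := by
    have h := Lp.coeFn_add f g
    filter_upwards [hf, hg, h, quasiMeasurePreserving_neg.ae h] with p h1 h2 h3 h4
    simp only [h3, h4, Pi.add_apply, h1, h2]
    ring
  zero_mem' := by
    have h := Lp.coeFn_zero ℂ 2 torus
    filter_upwards [h, quasiMeasurePreserving_neg.ae h] with p h1 h2
    simp only [h1, h2, Pi.zero_apply, neg_zero]
  smul_mem' c f hf := by
    have h := Lp.coeFn_smul c f
    filter_upwards [hf, h, quasiMeasurePreserving_neg.ae h] with p h1 h2 h3
    simp only [h2, h3, Pi.smul_apply, h1, smul_neg]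

/-! ## The fiber Hamiltonians -/

/-- The dispersion relation `ℰ_K(p) = 2 ∑ᵢ (1 - cos (Kᵢ/2) cos pᵢ)`. -/
def energy (K p : ℝ × ℝ) : ℝ :=
  2 * ((1 - Real.cos (K.1 / 2) * Real.cos p.1) + (1 - Real.cos (K.2 / 2) * Real.cos p.2))

theorem memLp_energy (K : ℝ × ℝ) : MemLp (fun p => (energy K p : ℂ)) ⊤ torus := by
  refine memLp_top_of_bound (C := 8) ?_ (Filter.Eventually.of_forall fun p => ?_)
  · refine Continuous.aestronglyMeasurable ?_
    unfold energy
    fun_prop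
  · have key : ∀ x y : ℝ, |Real.cos x * Real.cos y| ≤ 1 := fun x y => by
      rw [abs_mul]
      exact mul_le_one₀ (Real.abs_cos_le_one x) (abs_nonneg _) (Real.abs_cos_le_one y)
    rw [Complex.norm_real, Real.norm_eq_abs, energy, abs_le]
    have h1 := abs_le.1 (key (K.1 / 2) p.1)
    have h2 := abs_le.1 (key (K.2 / 2) p.2)
    constructor <;> linarith [h1.1, h1.2, h2.1, h2.2]

/-- Multiplication by `ℰ_K` on `L²(𝕋²)`. -/
def mulEnergy (K : ℝ × ℝ) : Lp ℂ 2 torus →L[ℂ] Lp ℂ 2 torus :=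
  (ContinuousLinearMap.mul ℂ ℂ).holderL torus ⊤ 2 2 ((memLp_energy K).toLp _)

theorem coeFn_mulEnergy (K : ℝ × ℝ) (f : Lp ℂ 2 torus) :
    mulEnergy K f =ᵐ[torus] fun p => (energy K p : ℂ) * f p := by
  have h := (ContinuousLinearMap.mul ℂ ℂ).coeFn_holder (r := 2) ((memLp_energy K).toLp _) f
  filter_upwards [h, (memLp_energy K).coeFn_toLp] with p h1 h2
  rw [mulEnergy, ContinuousLinearMap.holderL_apply_apply, h1, h2]
  rfl

theorem mulEnergy_mem (K : ℝ × ℝ) (f : Lp ℂ 2 torus) (hf : f ∈ oddL2) :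
    mulEnergy K f ∈ oddL2 := by
  have h := coeFn_mulEnergy K f
  have hf' : ∀ᵐ p ∂torus, f (-p) = -f p := hf
  change ∀ᵐ p ∂torus, mulEnergy K f (-p) = -mulEnergy K f p
  filter_upwards [hf', h, quasiMeasurePreserving_neg.ae h] with p h1 h2 h3
  rw [h3, h2, h1]
  simp [energy]

/-- The kinetic-energy operator `H₀(K)`: multiplication by `ℰ_K` on `L^{2,o}(𝕋²)`. -/
def freeHamiltonian (K : ℝ × ℝ) : oddL2 →L[ℂ] oddL2 :=
  ((mulEnergy K).comp oddL2.subtypeL).codRestrict oddL2 fun f => mulEnergy_mem K f f.2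

theorem memLp_of_continuous_of_le_one {φ : ℝ × ℝ → ℝ} (hc : Continuous φ)
    (hb : ∀ p, |φ p| ≤ 1) : MemLp (fun p => (φ p : ℂ)) 2 torus :=
  MemLp.of_bound (Complex.continuous_ofReal.comp hc).aestronglyMeasurable 1
    (Filter.Eventually.of_forall fun p => by
      rw [Complex.norm_real, Real.norm_eq_abs]; exact hb p)

/-- A continuous odd function `φ` with `|φ| ≤ 1`, as an element of `L^{2,o}(𝕋²)`. -/
def oddVec (φ : ℝ × ℝ → ℝ) (hc : Continuous φ) (hb : ∀ p, |φ p| ≤ 1)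
    (ho : ∀ p, φ (-p) = -φ p) : oddL2 :=
  ⟨(memLp_of_continuous_of_le_one hc hb).toLp _, by
    have h := (memLp_of_continuous_of_le_one hc hb).coeFn_toLp
    change ∀ᵐ p ∂torus, _
    filter_upwards [h, quasiMeasurePreserving_neg.ae h] with p h1 h2
    rw [h1, h2, ho]
    simp⟩

theorem abs_sin_mul_cos_le (x y : ℝ) : |Real.sin x * Real.cos y| ≤ 1 := by
  rw [abs_mul]
  exact mul_le_one₀ (Real.abs_sin_le_one x) (abs_nonneg _) (Real.abs_cos_le_one y)

/-- `sin p₁`. -/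
def sinFst : oddL2 := oddVec (fun p => Real.sin p.1) (by fun_prop)
  (fun p => Real.abs_sin_le_one _) (fun p => by simp)

/-- `sin p₂`. -/
def sinSnd : oddL2 := oddVec (fun p => Real.sin p.2) (by fun_prop)
  (fun p => Real.abs_sin_le_one _) (fun p => by simp)

/-- `sin 2p₁`. -/
def sinTwoFst : oddL2 := oddVec (fun p => Real.sin (2 * p.1)) (by fun_prop)
  (fun p => Real.abs_sin_le_one _) (fun p => by simp)

/-- `sin 2p₂`. -/
def sinTwoSnd : oddL2 := oddVec (fun p => Real.sin (2 * p.2)) (by fun_prop)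
  (fun p => Real.abs_sin_le_one _) (fun p => by simp)

/-- `sin p₁ cos p₂`. -/
def sinFstCosSnd : oddL2 := oddVec (fun p => Real.sin p.1 * Real.cos p.2) (by fun_prop)
  (fun p => abs_sin_mul_cos_le _ _) (fun p => by simp)

/-- `sin p₂ cos p₁`. -/
def sinSndCosFst : oddL2 := oddVec (fun p => Real.sin p.2 * Real.cos p.1) (by fun_prop)
  (fun p => abs_sin_mul_cos_le _ _) (fun p => by simp)

/-- For a real function `φ`, the rank-one integral operator `(P f)(s) = φ(s) ∫ φ(t) f(t) dt`. -/
def rankOne (φ : oddL2) : oddL2 →L[ℂ] oddL2 := (innerSL ℂ φ).smulRight φ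

/-- The interaction operator `V_{λμ}`, i.e. the restriction to the odd functions of
`f ↦ (2π)⁻² ∫ v_{λμ}(· - t) f(t) dt` with
`v_{λμ}(p) = λ (cos p₁ + cos p₂) + μ (cos 2p₁ + cos 2p₂) + 4 μ cos p₁ cos p₂`. -/
def interaction (lam mu : ℝ) : oddL2 →L[ℂ] oddL2 :=
  ((lam / (2 * Real.pi) ^ 2 : ℝ) : ℂ) • (rankOne sinFst + rankOne sinSnd)
  + ((mu / (2 * Real.pi) ^ 2 : ℝ) : ℂ) • (rankOne sinTwoFst + rankOne sinTwoSnd)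
  + ((mu / Real.pi ^ 2 : ℝ) : ℂ) • (rankOne sinFstCosSnd + rankOne sinSndCosFst)

/-- The fiber Hamiltonian (discrete Schrödinger operator) `H_{λμ}(K) = H₀(K) + V_{λμ}`. -/
def hamiltonian (lam mu : ℝ) (K : ℝ × ℝ) : oddL2 →L[ℂ] oddL2 :=
  freeHamiltonian K + interaction lam mu

/-! ## Essential spectrum and numbers of eigenvalues -/

section Spectral

variable {E : Type*} [NormedAddCommGroup E] [NormedSpace ℂ E]

/-- The essential spectrum: all `z` such that `T - z` is not a Fredholm operator. -/
def essSpectrum (T : E →L[ℂ] E) : Set ℂ :=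
  {z | ¬ (T - z • ContinuousLinearMap.id ℂ E).IsFredholm}

/-- The number `n₋(T)` of (real) eigenvalues of `T` below its essential spectrum, counted with
multiplicity: eigenspaces being independent, the sum of the dimensions of the eigenspaces is the
dimension of their span. -/
def numBelow (T : E →L[ℂ] E) : Cardinal :=
  Module.rank ℂ (⨆ z ∈ {z : ℝ | ∀ w ∈ essSpectrum T, z < w.re},
    Module.End.eigenspace (T : Module.End ℂ E) (z : ℂ) : Submodule ℂ E)

/-- The number `n₊(T)` of (real) eigenvalues of `T` above its essential spectrum, counted with
multiplicity. -/
def numAbove (T : E →L[ℂ] E) : Cardinal :=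
  Module.rank ℂ (⨆ z ∈ {z : ℝ | ∀ w ∈ essSpectrum T, w.re < z},
    Module.End.eigenspace (T : Module.End ℂ E) (z : ℂ) : Submodule ℂ E)

end Spectral

/-! ## The partition of the plane of parameters -/

open Real in
/-- `μ₀⁺` -/
def mu0p : ℝ := (88 - 30 * π + √(1044 * π ^ 2 - 6720 * π + 10816))
  / (240 * π - 24 * π ^ 2 - 512) * π

open Real in
/-- `μ₀⁻` -/
def mu0m : ℝ := (88 - 30 * π - √(1044 * π ^ 2 - 6720 * π + 10816))
  / (240 * π - 24 * π ^ 2 - 512) * π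

open Real in
/-- `μ₁⁺` -/
def mu1p : ℝ := (128 - 16 * π - 9 * π ^ 2
    + √(225 * π ^ 4 - 1440 * π ^ 3 + 3904 * π ^ 2 - 10240 * π + 16384))
  / (120 * π - 12 * π ^ 2 - 256)

open Real in
/-- `μ₁⁻` -/
def mu1m : ℝ := (128 - 16 * π - 9 * π ^ 2
    - √(225 * π ^ 4 - 1440 * π ^ 3 + 3904 * π ^ 2 - 10240 * π + 16384))
  / (120 * π - 12 * π ^ 2 - 256)

open Real in
/-- `C⁻(λ, μ)` -/
def cMinus (lam mu : ℝ) : ℝ :=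
  (30 * π - 3 * π ^ 2 - 64) / (6 * π ^ 2) *
    (8 * (mu - mu0p) * (mu - mu0m) + lam * (mu - mu1p) * (mu - mu1m))

open Real in
/-- `C⁺(λ, μ)` -/
def cPlus (lam mu : ℝ) : ℝ :=
  (30 * π - 3 * π ^ 2 - 64) / (6 * π ^ 2) *
    (8 * (mu + mu0p) * (mu + mu0m) - lam * (mu + mu1p) * (mu + mu1m))

/-- The curve `C⁻ = 0` as a graph over the `μ`-axis. -/
def curveMinus (mu : ℝ) : ℝ :=
  -(8 * (mu - mu0p) * (mu - mu0m)) / ((mu - mu1p) * (mu - mu1m))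

/-- The curve `C⁺ = 0` as a graph over the `μ`-axis. -/
def curvePlus (mu : ℝ) : ℝ :=
  8 * (mu + mu0p) * (mu + mu0m) / ((mu + mu1p) * (mu + mu1m))

/-- The sets `𝒞₀⁻, 𝒞₁⁻, 𝒞₂⁻, 𝒞₃⁻` of pairs `x = (λ, μ)`. -/
def compMinus : Fin 4 → Set (ℝ × ℝ)
  | 0 => {x | curveMinus x.2 < x.1 ∧ mu1p < x.2}
  | 1 => {x | x.1 < curveMinus x.2 ∧ mu1p < x.2} ∪ {x | x.2 = mu1p} ∪
      {x | curveMinus x.2 < x.1 ∧ mu1m < x.2 ∧ x.2 < mu1p}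
  | 2 => {x | x.1 < curveMinus x.2 ∧ mu1m < x.2 ∧ x.2 < mu1p} ∪ {x | x.2 = mu1m} ∪
      {x | curveMinus x.2 < x.1 ∧ x.2 < mu1m}
  | 3 => {x | x.1 < curveMinus x.2 ∧ x.2 < mu1m}

/-- The sets `𝒞₀⁺, 𝒞₁⁺, 𝒞₂⁺, 𝒞₃⁺` of pairs `x = (λ, μ)`. -/
def compPlus : Fin 4 → Set (ℝ × ℝ)
  | 0 => {x | x.1 < curvePlus x.2 ∧ x.2 < -mu1p}
  | 1 => {x | curvePlus x.2 < x.1 ∧ x.2 < -mu1p} ∪ {x | x.2 = -mu1p} ∪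
      {x | x.1 < curvePlus x.2 ∧ -mu1p < x.2 ∧ x.2 < -mu1m}
  | 2 => {x | curvePlus x.2 < x.1 ∧ -mu1p < x.2 ∧ x.2 < -mu1m} ∪ {x | x.2 = -mu1m} ∪
      {x | x.1 < curvePlus x.2 ∧ -mu1m < x.2}
  | 3 => {x | curvePlus x.2 < x.1 ∧ -mu1m < x.2}

/-- The sets `C k` are the connected components of `U`, without repetition. -/
def AreComponents (U : Set (ℝ × ℝ)) (C : Fin 4 → Set (ℝ × ℝ)) : Prop :=
  Function.Injective C ∧ Set.range C = {S | ∃ x ∈ U, S = connectedComponentIn U x}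

end TwoFermion

end

/-! Let A be multiplication by `weight 1`, which is the free Hamiltonian. The interaction V is a sum
of six rank one terms built from the functions `sin p₁`, `sin 2p₁`, `sin p₁ cos p₂` and their images
under exchange of variables. Since `sin² p₁` is at most the weight, these functions divided by the
square root of the weight stay bounded. Hence H = √A B √A with B = 1 + K, where K is self-adjoint of
finite rank and √A is self-adjoint and injective.

Inertia: if the form of B is negative on a finite-dimensional S and nonnegative on its complement,
then √A B √A has exactly dim S negative eigenvalues (`finrank_lowerSpan_conj`). If B is injective,
it is invertible and has a spectral gap around 0, so dim S is unchanged under small finite rank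
perturbations (`exists_finrank_lowerSpan_conj_eq`). The number of eigenvalues below 0 is therefore
locally constant in (λ, μ) wherever B is injective, hence constant on connected sets of such
parameters.

Injectivity of B is a finite-dimensional question. By parity and exchange symmetry the Gram matrix
of the six vectors consists of two equal 3 × 3 blocks. Explicit integration shows that the
corresponding 3 × 3 determinant is C⁻ (`det_birmanMatrix`). Eigenvalues above 8 are the negative
eigenvalues of 8 - H, which has the same structure with `weight (-1)` and parameters (-λ, -μ).
Translation by (π, π) shows that its determinant is again C⁻, now at the reflected point, and this
value is C⁺(λ, μ).

The essential spectrum is that of A: V has finite rank, A - t is injective because level sets of the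
weight are null, and odd functions concentrated near a level set prevent A - t from being invertible
for t in [0, 8].

The description of the components rests on the order μ₁⁻ < μ₀⁻ < μ₁⁺ < μ₀⁺. It fixes the sign of C⁻
on the two lines where the coefficient of λ vanishes, and so decides which pieces of the plane are
glued across them. -/

open MeasureTheory

noncomputable section

namespace TwoFermion

/-! ### Eigenspaces below a level, and finite rank perturbations -/

section Abstract

open scoped InnerProductSpace

variable {E : Type*} [NormedAddCommGroup E] [InnerProductSpace ℂ E]

/-- The span of the eigenspaces of `T` for the real eigenvalues below `a`. -/
def lowerSpan (T : E →L[ℂ] E) (a : ℝ) : Submodule ℂ E :=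
  ⨆ z ∈ {z : ℝ | z < a}, Module.End.eigenspace (T : Module.End ℂ E) (z : ℂ)

theorem mem_lowerSpan_of_eigenvector {T : E →L[ℂ] E} {a z : ℝ} (hz : z < a) {f : E}
    (hf : T f = (z : ℂ) • f) : f ∈ lowerSpan T a :=
  Submodule.mem_iSup_of_mem z (Submodule.mem_iSup_of_mem hz (Module.End.mem_eigenspace_iff.2 hf))

theorem lowerSpan_induction {T : E →L[ℂ] E} {a : ℝ} {p : E → Prop}
    (h : ∀ z : ℝ, z < a → ∀ f : E, T f = (z : ℂ) • f → p f) (h0 : p 0)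
    (hadd : ∀ f g, p f → p g → p (f + g)) {f : E} (hf : f ∈ lowerSpan T a) : p f := by
  unfold lowerSpan at hf
  rw [iSup_subtype'] at hf
  refine Submodule.iSup_induction (motive := p) _ hf (fun z f hf => ?_) h0 hadd
  exact h z z.2 f (Module.End.mem_eigenspace_iff.1 hf)

theorem map_mem_lowerSpan {T : E →L[ℂ] E} {a : ℝ} {f : E} (hf : f ∈ lowerSpan T a) :
    T f ∈ lowerSpan T a := by
  refine lowerSpan_induction (p := fun f => T f ∈ lowerSpan T a) (fun z hz f hf => ?_)
    (by simp) (fun f g hf hg => by rw [map_add]; exact add_mem hf hg) hf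
  rw [hf]
  exact Submodule.smul_mem _ _ (mem_lowerSpan_of_eigenvector hz hf)

/-- Eigenvectors for distinct eigenvalues are orthogonal, so the form is a sum of squared norms
weighted by eigenvalues, all smaller than `a`. No finiteness of the spectrum is needed, since each
vector involves only finitely many eigenvalues. -/
theorem re_inner_lt_of_mem_lowerSpan {T : E →L[ℂ] E} (hT : (T : E →ₗ[ℂ] E).IsSymmetric)
    {a : ℝ} {f : E} (hf : f ∈ lowerSpan T a) (hf0 : f ≠ 0) :
    (⟪T f, f⟫_ℂ).re < a * ‖f‖ ^ 2 := by
  unfold lowerSpan at hf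
  rw [iSup_subtype'] at hf
  obtain ⟨g, hg, rfl⟩ := (Submodule.mem_iSup_iff_exists_finsupp _ _).1 hf
  have hTg : ∀ i, T (g i) = ((i : ℝ) : ℂ) • g i := fun i =>
    Module.End.mem_eigenspace_iff.1 (hg i)
  have horth : ∀ i j, i ≠ j → ⟪g i, g j⟫_ℂ = 0 := fun i j hij =>
    hT.orthogonalFamily_eigenspaces (i := ((i : ℝ) : ℂ)) (j := ((j : ℝ) : ℂ))
      (by simpa [Subtype.ext_iff] using hij) ⟨g i, hg i⟩ ⟨g j, hg j⟩
  -- Used twice: with the eigenvalues as coefficients it gives the form of `T`, and with all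
  -- coefficients 1 it gives the squared norm.
  have hsum : ∀ c : {z : ℝ // z ∈ {z : ℝ | z < a}} → ℂ,
      ⟪∑ i ∈ g.support, c i • g i, ∑ i ∈ g.support, g i⟫_ℂ =
        ∑ i ∈ g.support, star (c i) * (‖g i‖ : ℂ) ^ 2 := by
    intro c
    rw [sum_inner]
    refine Finset.sum_congr rfl fun i hi => ?_
    rw [inner_sum, Finset.sum_eq_single i]
    · rw [inner_smul_left, inner_self_eq_norm_sq_to_K]; rfl
    · intro j _ hj
      rw [inner_smul_left, horth i j hj.symm, mul_zero]
    · exact fun h => absurd hi h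
  have h1 : (⟪T (g.sum fun _ x => x), g.sum fun _ x => x⟫_ℂ).re =
      ∑ i ∈ g.support, (i : ℝ) * ‖g i‖ ^ 2 := by
    rw [Finsupp.sum, map_sum, Finset.sum_congr rfl fun i _ => hTg i, hsum, Complex.re_sum]
    refine Finset.sum_congr rfl fun i _ => ?_
    rw [← Complex.ofReal_pow, Complex.star_def, Complex.conj_ofReal, ← Complex.ofReal_mul,
      Complex.ofReal_re]
  have h2 : ‖g.sum fun _ x => x‖ ^ 2 = ∑ i ∈ g.support, ‖g i‖ ^ 2 := by
    have := hsum 1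
    simp only [Pi.one_apply, one_smul, star_one, one_mul] at this
    rw [inner_self_eq_norm_sq_to_K] at this
    rw [Finsupp.sum]
    apply Complex.ofReal_injective
    push_cast
    exact this
  rw [h1, h2, Finset.mul_sum]
  refine Finset.sum_lt_sum_of_nonempty ?_ fun i hi => ?_
  · rw [Finset.nonempty_iff_ne_empty]
    intro h
    apply hf0
    rw [Finsupp.sum, h, Finset.sum_empty]
  · exact mul_lt_mul_of_pos_right i.2 (pow_pos (norm_pos_iff.2 (Finsupp.mem_support_iff.1 hi)) 2)

theorem algebraMap_real_eq (m : ℝ) :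
    algebraMap ℝ (E →L[ℂ] E) m = (m : ℂ) • (1 : E →L[ℂ] E) := by
  ext f
  simp [Algebra.algebraMap_eq_smul_one]

theorem re_inner_sub_smul (X : E →L[ℂ] E) (m : ℝ) (f : E) :
    (⟪(X - (m : ℂ) • (1 : E →L[ℂ] E)) f, f⟫_ℂ).re = (⟪X f, f⟫_ℂ).re - m * ‖f‖ ^ 2 := by
  have : (⟪f, f⟫_ℂ).re = ‖f‖ ^ 2 := by
    rw [inner_self_eq_norm_sq_to_K]; norm_cast
  simp only [_root_.sub_apply, _root_.smul_apply,
    one_apply_eq_self, inner_sub_left, inner_smul_left, Complex.conj_ofReal,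
    Complex.sub_re, Complex.re_ofReal_mul, this]

theorem isCompactOperator_of_hasFiniteRange {F : E →L[ℂ] E}
    (hF : (F : E →ₗ[ℂ] E).HasFiniteRange) : IsCompactOperator F := by
  have : FiniteDimensional ℂ (F : E →ₗ[ℂ] E).range := Module.Finite.of_fg hF
  have h := isCompactOperator_id_iff_finiteDimensional.2 this
  have h2 := (h.comp_clm (F.codRestrict (F : E →ₗ[ℂ] E).range fun x => ⟨x, rfl⟩)).clm_comp
    (Submodule.subtypeL _)
  exact h2

theorem hasFiniteRange_congr {F G : E →ₗ[ℂ] E} (h : ∀ f, F f = G f) (hG : G.HasFiniteRange) :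
    F.HasFiniteRange := by
  rwa [LinearMap.ext h]

/-- The inverse of `W` is a parametrix: both of its products with `W + F` differ from the identity
by a finite rank operator. -/
theorem isFredholm_of_isUnit_add {W F : E →L[ℂ] E} (hW : IsUnit W)
    (hF : (F : E →ₗ[ℂ] E).HasFiniteRange) : (W + F).IsFredholm := by
  obtain ⟨u, rfl⟩ := hW
  refine ContinuousLinearMap.IsFredholm.of_isQuasiInverse (v := (↑u⁻¹ : E →L[ℂ] E)) ⟨?_, ?_⟩
  · refine LinearMap.FiniteRangeSetoid.equiv_iff_hasFiniteRange.2 ?_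
    refine hasFiniteRange_congr (fun f => ?_) (hF.comp_left ((↑u⁻¹ : E →L[ℂ] E) : E →ₗ[ℂ] E))
    have : (↑u⁻¹ : E →L[ℂ] E) ((u : E →L[ℂ] E) f) = f := by
      rw [← mul_apply_eq_comp, Units.inv_mul, one_apply_eq_self]
    simp [this]
  · refine LinearMap.FiniteRangeSetoid.equiv_iff_hasFiniteRange.2 ?_
    refine hasFiniteRange_congr (fun f => ?_) (hF.comp_right ((↑u⁻¹ : E →L[ℂ] E) : E →ₗ[ℂ] E))
    have : (u : E →L[ℂ] E) ((↑u⁻¹ : E →L[ℂ] E) f) = f := by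
      rw [← mul_apply_eq_comp, Units.mul_inv, one_apply_eq_self]
    simp [this]

variable [CompleteSpace E]

theorem nonneg_iff_re_inner {X : E →L[ℂ] E} (hX : IsSelfAdjoint X) :
    0 ≤ X ↔ ∀ f, 0 ≤ (⟪X f, f⟫_ℂ).re := by
  rw [ContinuousLinearMap.nonneg_iff_isPositive, ContinuousLinearMap.isPositive_def']
  simp [hX, ContinuousLinearMap.reApplyInnerSelf]

theorem isSelfAdjoint_mul_self {R : E →L[ℂ] E} (hR : IsSelfAdjoint R) :
    IsSelfAdjoint (R * R) := by
  rw [isSelfAdjoint_iff, star_mul, hR.star_eq]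

theorem re_inner_mul_self_nonneg {R : E →L[ℂ] E} (hR : IsSelfAdjoint R) (f : E) :
    0 ≤ (⟪(R * R) f, f⟫_ℂ).re := by
  have h : ⟪R (R f), f⟫_ℂ = ⟪R f, R f⟫_ℂ := hR.isSymmetric _ _
  rw [mul_apply_eq_comp, h]
  exact inner_self_nonneg (𝕜 := ℂ)

theorem isSelfAdjoint_innerSL_smulRight (φ : E) :
    IsSelfAdjoint ((innerSL ℂ φ).smulRight φ) := by
  rw [ContinuousLinearMap.isSelfAdjoint_iff_isSymmetric]
  intro f g
  simp [inner_smul_left, inner_smul_right, mul_comm]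

theorem isSelfAdjoint_real_smul_one (m : ℝ) : IsSelfAdjoint ((m : ℂ) • (1 : E →L[ℂ] E)) := by
  rw [isSelfAdjoint_iff, star_smul, star_one, Complex.star_def, Complex.conj_ofReal]

/-- A self-adjoint operator bounded below by `a` has no spectrum below `a`. -/
theorem isUnit_sub_of_lt {X : E →L[ℂ] E} (hX : IsSelfAdjoint X) {a m : ℝ}
    (ha : ∀ f, a * ‖f‖ ^ 2 ≤ (⟪X f, f⟫_ℂ).re) (hm : m < a) :
    IsUnit (X - (m : ℂ) • (1 : E →L[ℂ] E)) := by
  have hY : IsSelfAdjoint (X - (a : ℂ) • (1 : E →L[ℂ] E)) :=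
    hX.sub (isSelfAdjoint_real_smul_one a)
  have h0 : 0 ≤ X - (a : ℂ) • (1 : E →L[ℂ] E) := by
    rw [nonneg_iff_re_inner hY]
    intro f
    rw [re_inner_sub_smul]
    linarith [ha f]
  rw [StarOrderedRing.nonneg_iff_spectrum_nonneg (R := ℝ) _ hY] at h0
  have h1 : m - a ∉ spectrum ℝ (X - (a : ℂ) • (1 : E →L[ℂ] E)) := fun h => by
    linarith [h0 _ h]
  rw [spectrum.notMem_iff, algebraMap_real_eq, ← IsUnit.neg_iff] at h1
  convert h1 using 1
  push_cast
  rw [sub_smul]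
  abel

/-- A self-adjoint operator without spectrum below `0` is nonnegative. -/
theorem re_inner_nonneg_of_isUnit {X : E →L[ℂ] E} (hX : IsSelfAdjoint X)
    (h : ∀ m : ℝ, m < 0 → IsUnit (X - (m : ℂ) • (1 : E →L[ℂ] E))) (f : E) :
    0 ≤ (⟪X f, f⟫_ℂ).re := by
  refine (nonneg_iff_re_inner hX).1 ?_ f
  rw [StarOrderedRing.nonneg_iff_spectrum_nonneg (R := ℝ) _ hX]
  intro m hm
  by_contra! hlt
  rw [spectrum.mem_iff, algebraMap_real_eq] at hm
  apply hm
  rw [← IsUnit.neg_iff, neg_sub]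
  exact h m hlt

/-- The Fredholm alternative for a finite rank perturbation of an invertible operator. -/
theorem isUnit_add_of_injective {W F : E →L[ℂ] E} (hW : IsUnit W)
    (hF : (F : E →ₗ[ℂ] E).HasFiniteRange) (hinj : ∀ f, (W + F) f = 0 → f = 0) :
    IsUnit (W + F) := by
  obtain ⟨u, rfl⟩ := hW
  have hK : IsCompactOperator ((↑u⁻¹ : E →L[ℂ] E) * F) :=
    (isCompactOperator_of_hasFiniteRange hF).clm_comp _
  have hfac : (u : E →L[ℂ] E) + F = u * (1 + (↑u⁻¹ : E →L[ℂ] E) * F) := by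
    rw [mul_add, mul_one, ← mul_assoc, Units.mul_inv, one_mul]
  rw [hfac, Units.isUnit_units_mul]
  -- Since W⁻¹F is compact, -1 can lie in its spectrum only as an eigenvalue, and an eigenvector
  -- would be a kernel vector of `W + F`.
  by_contra hn
  have hs : (-1 : ℂ) ∈ spectrum ℂ ((↑u⁻¹ : E →L[ℂ] E) * F) := by
    rw [spectrum.mem_iff, map_neg, map_one, ← IsUnit.neg_iff]
    convert hn using 2
    abel
  obtain ⟨f, hf⟩ := ((hK.hasEigenvalue_iff_mem_spectrum (by norm_num)).2 hs).exists_hasEigenvector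
  refine hf.2 (hinj f ?_)
  rw [hfac]
  have h1 : ((↑u⁻¹ : E →L[ℂ] E) * F) f = (-1 : ℂ) • f := hf.apply_eq_smul
  rw [mul_apply_eq_comp, _root_.add_apply, h1]
  simp

end Abstract

/-! ### Counting negative eigenvalues: inertia and its stability -/

section Abstract

open scoped InnerProductSpace

variable {E : Type*} [NormedAddCommGroup E] [InnerProductSpace ℂ E] [CompleteSpace E]

/-- A self-adjoint operator which is a finite rank perturbation of an operator bounded below by `a`
has finitely many eigenvalues below `a`. -/
theorem finiteDimensional_lowerSpan {T A : E →L[ℂ] E} (hT : IsSelfAdjoint T) {a : ℝ}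
    (ha : ∀ f, a * ‖f‖ ^ 2 ≤ (⟪A f, f⟫_ℂ).re)
    (hF : ((T - A : E →L[ℂ] E) : E →ₗ[ℂ] E).HasFiniteRange) :
    FiniteDimensional ℂ (lowerSpan T a) := by
  -- The kernel of `T - A` has finite codimension. There `T = A` has form at least `a`, whereas the
  -- form of `T` is smaller than `a` on `lowerSpan T a`. The two subspaces meet only in 0.
  refine Module.Finite.of_fg (hF.cofg_ker.fg_of_disjoint ?_)
  rw [Submodule.disjoint_def]
  intro f hfS hf
  by_contra h0
  have h1 := re_inner_lt_of_mem_lowerSpan hT.isSymmetric hfS h0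
  have h2 : T f = A f := by
    have h3 : (T - A) f = 0 := hf
    rwa [_root_.sub_apply, sub_eq_zero] at h3
  rw [h2] at h1
  linarith [ha f]

/-- On the orthogonal complement of the eigenvectors below `a`, the operator is bounded below
by `a`. -/
theorem le_re_inner_of_mem_orthogonal_lowerSpan {T A : E →L[ℂ] E} (hT : IsSelfAdjoint T)
    (hA : IsSelfAdjoint A) {a : ℝ} (ha : ∀ f, a * ‖f‖ ^ 2 ≤ (⟪A f, f⟫_ℂ).re)
    (hF : ((T - A : E →L[ℂ] E) : E →ₗ[ℂ] E).HasFiniteRange) {f : E}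
    (hf : f ∈ (lowerSpan T a)ᗮ) : a * ‖f‖ ^ 2 ≤ (⟪T f, f⟫_ℂ).re := by
  have hfin := finiteDimensional_lowerSpan hT ha hF
  set S := lowerSpan T a with hS
  set P : E →L[ℂ] E := S.starProjection with hP
  set Q : E →L[ℂ] E := 1 - P with hQ
  set Ta : E →L[ℂ] E := T - (a : ℂ) • 1 with hTa
  have hPsa : IsSelfAdjoint P := isSelfAdjoint_starProjection S
  have hQsa : IsSelfAdjoint Q := (IsSelfAdjoint.one _).sub hPsa
  have hTasa : IsSelfAdjoint Ta := hT.sub (isSelfAdjoint_real_smul_one a)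
  have hQmem : ∀ g, Q g ∈ Sᗮ := fun g => by
    simp [hQ, hP, S.sub_starProjection_mem_orthogonal g]
  have hQfix : ∀ g ∈ Sᗮ, Q g = g := fun g hg => by
    simp [hQ, hP, (Submodule.starProjection_apply_eq_zero_iff S).2 hg]
  have hTamem : ∀ g ∈ Sᗮ, Ta g ∈ Sᗮ := by
    intro g hg u hu
    have h1 : ⟪u, Ta g⟫_ℂ = ⟪Ta u, g⟫_ℂ := (hTasa.isSymmetric u g).symm
    rw [h1]
    refine hg _ ?_
    simp only [hTa, _root_.sub_apply, _root_.smul_apply, one_apply_eq_self]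
    exact sub_mem (map_mem_lowerSpan hu) (Submodule.smul_mem _ _ hu)
  have hXsa : IsSelfAdjoint (Q * Ta * Q) := by
    have := hTasa.conjugate Q
    rwa [hQsa.star_eq] at this
  have hPfin : (P : E →ₗ[ℂ] E).HasFiniteRange := by
    have : FiniteDimensional ℂ (P : E →ₗ[ℂ] E).range := by
      rw [show (P : E →ₗ[ℂ] E).range = S from Submodule.range_starProjection S]
      exact hfin
    exact (Submodule.fg_iff_finiteDimensional _).2 this
  -- It suffices that the compression `Q * Ta * Q` has no negative spectrum. For `m < 0`,
  -- subtracting `m` leaves a finite rank perturbation of the invertible `A - (a + m)`, so only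
  -- injectivity is at stake. A kernel vector would lie in `Sᗮ` and be an eigenvector of `T` at `a +
  -- m < a`, hence lie in `S` as well.
  have key := re_inner_nonneg_of_isUnit hXsa (fun m hm => ?_) f
  · have h1 : (Q * Ta * Q) f = Q (Ta f) := by
      rw [mul_apply_eq_comp, mul_apply_eq_comp]
      simp [hQfix f hf]
    rw [h1, hQfix _ (hTamem f hf), re_inner_sub_smul] at key
    linarith
  · have hW := isUnit_sub_of_lt hA ha (show a + m < a by linarith)
    have hsplit : Q * Ta * Q - (m : ℂ) • (1 : E →L[ℂ] E) =
        (A - ((a + m : ℝ) : ℂ) • (1 : E →L[ℂ] E)) + ((T - A) - (Ta * P + P * (Ta * Q))) := by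
      rw [hQ, hTa]
      push_cast
      simp only [add_smul, sub_mul, mul_sub, smul_mul_assoc, mul_smul_comm, one_mul, mul_one,
        mul_assoc]
      module
    rw [hsplit]
    refine isUnit_add_of_injective hW ?_ fun g hg => ?_
    · exact LinearMap.HasFiniteRange.sub hF (LinearMap.HasFiniteRange.add
        (hPfin.comp_left (Ta : E →ₗ[ℂ] E))
        (hPfin.comp_right ((Ta * Q : E →L[ℂ] E) : E →ₗ[ℂ] E)))
    · rw [← hsplit] at hg
      have h1 : Q (Ta (Q g)) = (m : ℂ) • g := by
        have : Q (Ta (Q g)) - (m : ℂ) • g = 0 := hg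
        exact sub_eq_zero.1 this
      have hm0 : (m : ℂ) ≠ 0 := by exact_mod_cast hm.ne
      have hgS : g ∈ Sᗮ := by
        have : g = (m : ℂ)⁻¹ • Q (Ta (Q g)) := by rw [h1, inv_smul_smul₀ hm0]
        rw [this]
        exact Submodule.smul_mem _ _ (hQmem _)
      rw [hQfix g hgS, hQfix _ (hTamem g hgS)] at h1
      have h2 : T g = ((a + m : ℝ) : ℂ) • g := by
        have : T g - (a : ℂ) • g = (m : ℂ) • g := h1
        rw [sub_eq_iff_eq_add] at this
        rw [this, Complex.ofReal_add, add_smul, add_comm]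
      have h3 : g ∈ S := mem_lowerSpan_of_eigenvector (by linarith) h2
      exact inner_self_eq_zero.1 (hgS g h3)

/-- If the form of `B` is negative on `S` and nonnegative on its orthogonal complement, then the
number of negative eigenvalues of `R B R` is the dimension of `S`. -/
theorem finrank_lowerSpan_conj {R B : E →L[ℂ] E} (hR : IsSelfAdjoint R)
    (hRinj : ∀ f, R f = 0 → f = 0) (hB : IsSelfAdjoint B)
    (hF : ((B - 1 : E →L[ℂ] E) : E →ₗ[ℂ] E).HasFiniteRange)
    {S : Submodule ℂ E} [FiniteDimensional ℂ S]
    (hneg : ∀ f ∈ S, f ≠ 0 → (⟪B f, f⟫_ℂ).re < 0) (hpos : ∀ f ∈ Sᗮ, 0 ≤ (⟪B f, f⟫_ℂ).re) :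
    FiniteDimensional ℂ (lowerSpan (R * B * R) 0) ∧
      Module.finrank ℂ (lowerSpan (R * B * R) 0) = Module.finrank ℂ S := by
  have hT : IsSelfAdjoint (R * B * R) := by
    have := hB.conjugate R
    rwa [hR.star_eq] at this
  have hA : IsSelfAdjoint (R * R) := isSelfAdjoint_mul_self hR
  have hsymm : ∀ f g, ⟪R f, g⟫_ℂ = ⟪f, R g⟫_ℂ := hR.isSymmetric
  have ha : ∀ f, 0 * ‖f‖ ^ 2 ≤ (⟪(R * R) f, f⟫_ℂ).re := fun f => by
    rw [zero_mul]
    exact re_inner_mul_self_nonneg hR f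
  have hF' : ((R * B * R - R * R : E →L[ℂ] E) : E →ₗ[ℂ] E).HasFiniteRange := by
    have h1 : R * B * R - R * R = R * ((B - 1) * R) := by noncomm_ring
    rw [h1]
    exact LinearMap.HasFiniteRange.comp_left (hF.comp_right (R : E →ₗ[ℂ] E)) (R : E →ₗ[ℂ] E)
  have hfin := finiteDimensional_lowerSpan hT ha hF'
  have hform : ∀ f, ⟪(R * B * R) f, f⟫_ℂ = ⟪B (R f), R f⟫_ℂ := fun f => hsymm _ _
  refine ⟨hfin, le_antisymm ?_ ?_⟩
  -- Upper bound: apply `R`, then project onto `S`. A vector sent to 0 has `R f ∈ Sᗮ`, where the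
  -- form of `B` is nonnegative, although the form of `R * B * R` at `f` must be negative.
  · let Φ : lowerSpan (R * B * R) 0 →ₗ[ℂ] S :=
      (S.orthogonalProjectionOnto : E →ₗ[ℂ] S) ∘ₗ (R : E →ₗ[ℂ] E) ∘ₗ Submodule.subtype _
    refine LinearMap.finrank_le_finrank_of_injective (f := Φ) ?_
    rw [injective_iff_map_eq_zero]
    rintro ⟨f, hf⟩ h
    have h1 : R f ∈ Sᗮ := Submodule.orthogonalProjectionOnto_eq_zero_iff.1 h
    have h2 := hpos _ h1
    by_contra h0
    have h3 := re_inner_lt_of_mem_lowerSpan hT.isSymmetric hf (by simpa using h0)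
    rw [hform] at h3
    linarith
  -- Lower bound: `R` embeds `K`, the complement of `R N`, into the lower span. It remains to embed
  -- `S` into `K` by orthogonal projection.
  · set N := (lowerSpan (R * B * R) 0)ᗮ with hN
    set K : Submodule ℂ E := (N.map (R : E →ₗ[ℂ] E))ᗮ with hK
    have hKmem : ∀ f ∈ K, R f ∈ lowerSpan (R * B * R) 0 := by
      intro f hf
      rw [← Submodule.orthogonal_orthogonal (lowerSpan (R * B * R) 0)]
      intro g hg
      rw [← hsymm]
      exact hf _ ⟨g, hg, rfl⟩
    let Ψ : K →ₗ[ℂ] lowerSpan (R * B * R) 0 :=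
      ((R : E →ₗ[ℂ] E) ∘ₗ K.subtype).codRestrict _ fun f => hKmem f f.2
    have hΨ : Function.Injective Ψ := by
      rw [injective_iff_map_eq_zero]
      intro f h
      exact Subtype.ext (hRinj f (congrArg Subtype.val h))
    have : FiniteDimensional ℂ K := FiniteDimensional.of_injective Ψ hΨ
    refine le_trans ?_ (LinearMap.finrank_le_finrank_of_injective hΨ)
    let Φ : S →ₗ[ℂ] K := (K.orthogonalProjectionOnto : E →ₗ[ℂ] K) ∘ₗ S.subtype
    refine LinearMap.finrank_le_finrank_of_injective (f := Φ) ?_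
    rw [injective_iff_map_eq_zero]
    rintro ⟨s, hs⟩ h
    have h1 : s ∈ Kᗮ := Submodule.orthogonalProjectionOnto_eq_zero_iff.1 h
    rw [hK, Submodule.orthogonal_orthogonal_eq_closure] at h1
    -- A vector of `S` killed by the projection is a limit of vectors `R g` with `g ∈ N`, on which
    -- the form of `B` is nonnegative. Continuity extends this to the limit.
    have h2 : 0 ≤ (⟪B s, s⟫_ℂ).re := by
      have hcl : IsClosed {f : E | 0 ≤ (⟪B f, f⟫_ℂ).re} :=
        isClosed_le continuous_const (by fun_prop)
      refine closure_minimal ?_ hcl h1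
      rintro _ ⟨g, hg, rfl⟩
      change 0 ≤ (⟪B (R g), R g⟫_ℂ).re
      rw [← hform]
      simpa using le_re_inner_of_mem_orthogonal_lowerSpan hT hA ha hF' hg
    by_contra h0
    linarith [hneg s hs (by simpa using h0)]

/-- If `B` is invertible, the number of negative eigenvalues of `R B' R` is constant for `B'` near
`B`. -/
theorem exists_finrank_lowerSpan_conj_eq {R B : E →L[ℂ] E} (hR : IsSelfAdjoint R)
    (hRinj : ∀ f, R f = 0 → f = 0) (hB : IsSelfAdjoint B)
    (hF : ((B - 1 : E →L[ℂ] E) : E →ₗ[ℂ] E).HasFiniteRange) (hBinj : ∀ f, B f = 0 → f = 0) :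
    ∃ n : ℕ, ∃ δ > 0, ∀ B' : E →L[ℂ] E, IsSelfAdjoint B' →
      ((B' - 1 : E →L[ℂ] E) : E →ₗ[ℂ] E).HasFiniteRange → ‖B' - B‖ < δ →
      FiniteDimensional ℂ (lowerSpan (R * B' * R) 0) ∧
        Module.finrank ℂ (lowerSpan (R * B' * R) 0) = n := by
  have hunit : IsUnit B := by
    have := isUnit_add_of_injective (W := 1) (F := B - 1) isUnit_one hF
      (fun f hf => hBinj f (by rwa [add_sub_cancel] at hf))
    rwa [add_sub_cancel] at this
  obtain ⟨ε, hε, hball⟩ := Metric.isOpen_iff.1 (Units.isOpen (R := E →L[ℂ] E)) B hunit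
  -- The half of `ε` makes `[-δ, δ]` free of eigenvalues of `B`. The cap 1 makes `δ` a lower bound
  -- for the identity, of which `B` is a finite rank perturbation.
  set δ := min (ε / 2) 1 with hδ
  have hδ0 : 0 < δ := lt_min (by linarith) one_pos
  have hδε : δ < ε := lt_of_le_of_lt (min_le_left _ _) (by linarith)
  have hgap : ∀ z : ℝ, |z| ≤ δ → ∀ f, B f = (z : ℂ) • f → f = 0 := by
    intro z hz f hf
    have hmem : B - (z : ℂ) • (1 : E →L[ℂ] E) ∈ Metric.ball B ε := by
      rw [mem_ball_iff_norm, sub_sub_cancel_left, norm_neg, norm_smul, Complex.norm_real]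
      calc ‖z‖ * ‖(1 : E →L[ℂ] E)‖ ≤ ‖z‖ * 1 :=
            mul_le_mul_of_nonneg_left ContinuousLinearMap.norm_id_le (norm_nonneg _)
        _ < ε := by rw [mul_one, Real.norm_eq_abs]; linarith
    have hinj := (ContinuousLinearMap.isUnit_iff_bijective.1 (hball hmem)).1
    apply hinj
    rw [map_zero]
    simp [hf]
  have hA1 : ∀ f : E, δ * ‖f‖ ^ 2 ≤ (⟪(1 : E →L[ℂ] E) f, f⟫_ℂ).re := by
    intro f
    have : (⟪f, f⟫_ℂ).re = ‖f‖ ^ 2 := by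
      rw [inner_self_eq_norm_sq_to_K]; norm_cast
    rw [one_apply_eq_self, this]
    exact mul_le_of_le_one_left (sq_nonneg _) (min_le_right _ _)
  have hfin : FiniteDimensional ℂ (lowerSpan B δ) := finiteDimensional_lowerSpan hB hA1 hF
  have hle : lowerSpan B δ ≤ lowerSpan B (-δ) := by
    intro f hf
    refine lowerSpan_induction (p := fun f => f ∈ lowerSpan B (-δ)) (fun z hz f hf => ?_)
      (zero_mem _) (fun f g => add_mem) hf
    rcases lt_or_ge z (-δ) with h | h
    · exact mem_lowerSpan_of_eigenvector h hf
    · rw [hgap z (abs_le.2 ⟨h, hz.le⟩) f hf]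
      exact zero_mem _
  refine ⟨Module.finrank ℂ (lowerSpan B δ), δ, hδ0, fun B' hB' hF' hlt => ?_⟩
  have hdiff : ∀ f, |(⟪B' f, f⟫_ℂ).re - (⟪B f, f⟫_ℂ).re| ≤ δ * ‖f‖ ^ 2 := by
    intro f
    rw [← Complex.sub_re, ← inner_sub_left, ← _root_.sub_apply]
    calc |(⟪(B' - B) f, f⟫_ℂ).re| ≤ ‖⟪(B' - B) f, f⟫_ℂ‖ := Complex.abs_re_le_norm _
      _ ≤ ‖(B' - B) f‖ * ‖f‖ := norm_inner_le_norm _ _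
      _ ≤ (‖B' - B‖ * ‖f‖) * ‖f‖ :=
        mul_le_mul_of_nonneg_right (ContinuousLinearMap.le_opNorm _ _) (norm_nonneg _)
      _ = ‖B' - B‖ * ‖f‖ ^ 2 := by ring
      _ ≤ δ * ‖f‖ ^ 2 := mul_le_mul_of_nonneg_right hlt.le (sq_nonneg _)
  -- By the gap, the form of `B` is below `-δ` on nonzero unit-normalised vectors of `S = lowerSpan
  -- B δ` and at least `δ` on those of the complement. A perturbation of norm less than `δ`
  -- preserves both signs.
  refine finrank_lowerSpan_conj hR hRinj hB' hF' (fun f hf hf0 => ?_) (fun f hf => ?_)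
  · have h1 := re_inner_lt_of_mem_lowerSpan hB.isSymmetric (hle hf) hf0
    linarith [(abs_le.1 (hdiff f)).2]
  · have h1 := le_re_inner_of_mem_orthogonal_lowerSpan hB (IsSelfAdjoint.one _) hA1 hF hf
    linarith [(abs_le.1 (hdiff f)).1]

/-- A self-adjoint operator with `0 ≤ A ≤ b` has spectrum in `[0, b]`. -/
theorem isUnit_sub_smul_of_notMem {A : E →L[ℂ] E} (hA : IsSelfAdjoint A) {b : ℝ}
    (h0 : ∀ f, 0 ≤ (⟪A f, f⟫_ℂ).re) (hb : ∀ f, 0 ≤ (⟪((b : ℂ) • (1 : E →L[ℂ] E) - A) f, f⟫_ℂ).re)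
    {z : ℂ} (hz : z ∉ ((↑) : ℝ → ℂ) '' Set.Icc 0 b) :
    IsUnit (A - z • ContinuousLinearMap.id ℂ E) := by
  by_cases hre : z = (z.re : ℂ)
  · have hz' : z.re < 0 ∨ b < z.re := by
      by_contra! h
      exact hz ⟨z.re, h, hre.symm⟩
    rw [hre]
    rcases hz' with h | h
    · exact isUnit_sub_of_lt hA (a := 0) (fun f => by simpa using h0 f) h
    · have h1 := isUnit_sub_of_lt hA.neg (a := -b) (m := -z.re) (fun f => ?_) (by linarith)
      · rw [← IsUnit.neg_iff] at h1
        convert h1 using 1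
        push_cast
        rw [neg_smul, sub_neg_eq_add, neg_add, neg_neg, sub_eq_add_neg]
        rfl
      · have h2 := re_inner_sub_smul (-A) (-b) f
        rw [show -A - ((-b : ℝ) : ℂ) • (1 : E →L[ℂ] E) = (b : ℂ) • 1 - A by
          push_cast; rw [neg_smul]; abel] at h2
        linarith [hb f]
  · by_contra hn
    refine hre (IsSelfAdjoint.mem_spectrum_eq_re hA ?_)
    rw [spectrum.mem_iff, ← IsUnit.neg_iff, neg_sub, Algebra.algebraMap_eq_smul_one]
    exact hn

/-- An injective self-adjoint operator which is Fredholm up to a finite rank perturbation is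
invertible. -/
theorem isUnit_of_isFredholm_add {W F : E →L[ℂ] E} (hW : IsSelfAdjoint W)
    (hinj : ∀ f, W f = 0 → f = 0) (hF : (F : E →ₗ[ℂ] E).HasFiniteRange)
    (h : (W + F).IsFredholm) : IsUnit W := by
  obtain ⟨v, hv⟩ := h.exists_isQuasiInverse
  have heq : LinearMap.FiniteRangeSetoid.setoid.r (W : E →ₗ[ℂ] E)
      ((W + F : E →L[ℂ] E) : E →ₗ[ℂ] E) := by
    refine LinearMap.FiniteRangeSetoid.equiv_iff_hasFiniteRange.2 ?_
    refine hasFiniteRange_congr (fun f => ?_) hF.neg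
    simp
  have hfr : W.IsFredholm := ContinuousLinearMap.IsFredholm.of_isQuasiInverse
    (hv.congr ((LinearMap.FiniteRangeSetoid.setoid).refl _) heq)
  rw [ContinuousLinearMap.isUnit_iff_bijective]
  refine ⟨(injective_iff_map_eq_zero W).2 hinj, ?_⟩
  -- For self-adjoint `W` the complement of the range is the kernel, here 0. The Fredholm property
  -- supplies closedness of the range, hence surjectivity.
  have hperp : (W : E →ₗ[ℂ] E).rangeᗮ = ⊥ := by
    rw [eq_bot_iff]
    intro f hf
    refine hinj f (inner_self_eq_zero (𝕜 := ℂ).1 ?_)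
    have h1 : ⟪W (W f), f⟫_ℂ = 0 := hf _ ⟨W f, rfl⟩
    have h2 : ⟪W (W f), f⟫_ℂ = ⟪W f, W f⟫_ℂ := hW.isSymmetric _ _
    rw [← h2, h1]
  have hclosed := hfr.isClosed_range
  have htop : (W : E →ₗ[ℂ] E).range = ⊤ := by
    rw [← Submodule.topologicalClosure_eq_top_iff] at hperp
    rwa [hclosed.submodule_topologicalClosure_eq] at hperp
  exact LinearMap.range_eq_top.1 htop

end Abstract

/-! ### Reduction of the kernel of 1 + K to a 3 × 3 determinant -/

section Pairs

open scoped InnerProductSpace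

variable {E : Type*} [NormedAddCommGroup E] [InnerProductSpace ℂ E]

theorem eq_zero_of_one_add_mul_diagonal {G : Matrix (Fin 3) (Fin 3) ℝ} {c : Fin 3 → ℝ}
    (hdet : (1 + G * Matrix.diagonal c).det ≠ 0) {y : Fin 3 → ℂ}
    (hy : ∀ j, y j + ∑ k, (G j k : ℂ) * ((c k : ℂ) * y k) = 0) : y = 0 := by
  refine Matrix.eq_zero_of_mulVec_eq_zero
    (M := Complex.ofRealHom.mapMatrix (1 + G * Matrix.diagonal c)) ?_ ?_
  · rw [← RingHom.map_det]
    exact fun h => hdet (Complex.ofReal_eq_zero.1 h)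
  · ext j
    rw [Pi.zero_apply, ← hy j, map_add, map_one, Matrix.add_mulVec, Matrix.one_mulVec,
      Pi.add_apply]
    congr 1
    simp [Matrix.mulVec, dotProduct, Matrix.mul_diagonal, mul_assoc]

/-- A sum of rank one operators which come in pairs with equal coefficients. -/
def pairSum (ψ : Fin 2 → Fin 3 → E) (c : Fin 3 → ℝ) : E →L[ℂ] E :=
  ∑ k, (c k : ℂ) • ((innerSL ℂ (ψ 0 k)).smulRight (ψ 0 k) +
    (innerSL ℂ (ψ 1 k)).smulRight (ψ 1 k))

theorem pairSum_apply (ψ : Fin 2 → Fin 3 → E) (c : Fin 3 → ℝ) (f : E) :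
    pairSum ψ c f = ∑ k, (c k : ℂ) • (⟪ψ 0 k, f⟫_ℂ • ψ 0 k + ⟪ψ 1 k, f⟫_ℂ • ψ 1 k) := by
  simp [pairSum]

theorem pairSum_neg (ψ : Fin 2 → Fin 3 → E) (c : Fin 3 → ℝ) :
    pairSum ψ (-c) = -pairSum ψ c := by
  simp [pairSum, -smul_add]

theorem continuous_pairSum (ψ : Fin 2 → Fin 3 → E) : Continuous (pairSum ψ) := by
  unfold pairSum
  fun_prop

theorem eventually_norm_one_add_pairSum_sub_lt (ψ : Fin 2 → Fin 3 → E) (c : Fin 3 → ℝ) {δ : ℝ}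
    (hδ : 0 < δ) : ∀ᶠ c' in nhds c, ‖(1 + pairSum ψ c') - (1 + pairSum ψ c)‖ < δ := by
  filter_upwards [(continuous_pairSum ψ).continuousAt.eventually_mem
    (Metric.ball_mem_nhds (pairSum ψ c) hδ)] with c' hc'
  rw [add_sub_add_left_eq_sub]
  exact mem_ball_iff_norm.1 hc'

theorem hasFiniteRange_pairSum (ψ : Fin 2 → Fin 3 → E) (c : Fin 3 → ℝ) :
    (pairSum ψ c : E →ₗ[ℂ] E).HasFiniteRange := by
  have h1 : ∀ φ : E, (((innerSL ℂ φ).smulRight φ : E →L[ℂ] E) : E →ₗ[ℂ] E).HasFiniteRange := by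
    intro φ
    refine Submodule.FG.of_le (Submodule.fg_span_singleton φ) ?_
    rintro _ ⟨f, rfl⟩
    exact Submodule.smul_mem _ _ (Submodule.mem_span_singleton_self φ)
  rw [pairSum, Fin.sum_univ_three]
  exact (LinearMap.HasFiniteRange.add (((h1 _).add (h1 _)).smul _)
    (((h1 _).add (h1 _)).smul _)).add (((h1 _).add (h1 _)).smul _)

/-- Triviality of the kernel of `1 + pairSum ψ c` if the Gram matrix splits into two equal blocks
and the corresponding determinant does not vanish. -/
theorem one_add_pairSum_injective {ψ : Fin 2 → Fin 3 → E} {c : Fin 3 → ℝ}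
    {G : Matrix (Fin 3) (Fin 3) ℝ} (hG : ∀ s j k, ⟪ψ s j, ψ s k⟫_ℂ = (G j k : ℂ))
    (horth : ∀ j k, ⟪ψ 0 j, ψ 1 k⟫_ℂ = 0)
    (hdet : (1 + G * Matrix.diagonal c).det ≠ 0) (f : E) (hf : (1 + pairSum ψ c) f = 0) :
    f = 0 := by
  have horth' : ∀ j k, ⟪ψ 1 j, ψ 0 k⟫_ℂ = 0 := fun j k => by
    rw [← inner_conj_symm, horth, map_zero]
  have hsum : f = -∑ k, (c k : ℂ) • (⟪ψ 0 k, f⟫_ℂ • ψ 0 k + ⟪ψ 1 k, f⟫_ℂ • ψ 1 k) := by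
    rw [← pairSum_apply]
    exact eq_neg_of_add_eq_zero_left hf
  -- Pairing the kernel equation with `ψ 0 j` removes the second family by orthogonality. The
  -- numbers `⟪ψ 0 k, f⟫` then solve the homogeneous system with matrix `1 + G * diagonal c`.
  have h0 : (fun k => ⟪ψ 0 k, f⟫_ℂ) = 0 := by
    refine eq_zero_of_one_add_mul_diagonal hdet fun j => ?_
    have h := congrArg (fun g => ⟪ψ 0 j, g⟫_ℂ) hsum
    simp only [inner_neg_right, inner_sum, inner_smul_right, inner_add_right, hG, horth,
      mul_zero, add_zero] at h
    rw [h, neg_add_eq_zero]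
    exact Finset.sum_congr rfl fun k _ => by ring
  have h1 : (fun k => ⟪ψ 1 k, f⟫_ℂ) = 0 := by
    refine eq_zero_of_one_add_mul_diagonal hdet fun j => ?_
    have h := congrArg (fun g => ⟪ψ 1 j, g⟫_ℂ) hsum
    simp only [inner_neg_right, inner_sum, inner_smul_right, inner_add_right, hG, horth',
      mul_zero, zero_add] at h
    rw [h, neg_add_eq_zero]
    exact Finset.sum_congr rfl fun k _ => by ring
  rw [hsum]
  simp [fun k => congrFun h0 k, fun k => congrFun h1 k]

variable [CompleteSpace E]

theorem isSelfAdjoint_one_add_pairSum (ψ : Fin 2 → Fin 3 → E) (c : Fin 3 → ℝ) :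
    IsSelfAdjoint (1 + pairSum ψ c) := by
  refine (IsSelfAdjoint.one (E →L[ℂ] E)).add ?_
  refine isSelfAdjoint_sum _ fun k _ => IsSelfAdjoint.smul (Complex.conj_ofReal _)
    ((isSelfAdjoint_innerSL_smulRight _).add (isSelfAdjoint_innerSL_smulRight _))

theorem conj_pairSum {R : E →L[ℂ] E} (hR : IsSelfAdjoint R) (ψ : Fin 2 → Fin 3 → E)
    (c : Fin 3 → ℝ) : R * pairSum ψ c * R = pairSum (fun s k => R (ψ s k)) c := by
  have h : ∀ f g, ⟪R f, g⟫_ℂ = ⟪f, R g⟫_ℂ := hR.isSymmetric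
  ext1 f
  simp only [mul_apply_eq_comp, pairSum_apply, h, map_sum, map_smul, map_add]

end Pairs

/-! ## Explicit integrals -/

section Integrals

open Real intervalIntegral

theorem sqrt_eq_of_eq_sq {a b : ℝ} (h : a = b ^ 2) (hb : 0 ≤ b) : √a = b := by
  rw [h, sqrt_sq hb]

/-- With r = a - √(a² - 1), the root in (0, 1) of r² - 2ar + 1, one has 2r(a - cos y) = |1 - r
e^{iy}|². The integrand is thus a multiple of the Poisson kernel. The antiderivative below uses the
argument of 1 - r e^{iy}, which is smooth on the whole line because 1 - r cos y > 0, and its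
arctangent term vanishes at ±π. -/
theorem integral_inv_sub_cos {a : ℝ} (ha : 1 < a) :
    ∫ y in -π..π, (a - cos y)⁻¹ = 2 * π / √(a ^ 2 - 1) := by
  have hs2 : √(a ^ 2 - 1) ^ 2 = a ^ 2 - 1 := sq_sqrt (by nlinarith)
  have hs0 : 0 < √(a ^ 2 - 1) := sqrt_pos.2 (by nlinarith)
  set s := √(a ^ 2 - 1) with hs
  have hsa : s < a := by nlinarith
  set r := a - s with hr
  have hr0 : 0 < r := by linarith
  have hr1 : r < 1 := by nlinarith
  have hrel : 1 + r ^ 2 = 2 * a * r := by rw [hr]; nlinarith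
  have hrel2 : 1 - r ^ 2 = 2 * s * r := by rw [hr]; nlinarith
  have hden : ∀ y, 0 < 1 - r * cos y := fun y => by nlinarith [cos_le_one y]
  have hac : ∀ y, 0 < a - cos y := fun y => by linarith [cos_le_one y]
  have hderiv : ∀ y, HasDerivAt
      (fun y => (y + 2 * arctan (r * sin y / (1 - r * cos y))) / s) ((a - cos y)⁻¹) y := by
    intro y
    have h1 : HasDerivAt (fun y => r * sin y) (r * cos y) y := (hasDerivAt_sin y).const_mul r
    have h2 : HasDerivAt (fun y => 1 - r * cos y) (-(r * -sin y)) y :=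
      ((hasDerivAt_cos y).const_mul r).const_sub 1
    have h4 := ((hasDerivAt_id y).add ((h1.div h2 (hden y).ne').arctan.const_mul 2)).div_const s
    refine h4.congr_deriv ?_
    have hd := (hden y).ne'
    have hq : (1 - r * cos y) ^ 2 + (r * sin y) ^ 2 = 2 * r * (a - cos y) := by
      nlinarith [sin_sq_add_cos_sq y]
    have hq0 : (1 - r * cos y) ^ 2 + (r * sin y) ^ 2 ≠ 0 := by
      rw [hq]; exact (mul_pos (by linarith) (hac y)).ne'
    have e1 : 1 / (1 + (r * sin y / (1 - r * cos y)) ^ 2) *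
        ((r * cos y * (1 - r * cos y) - r * sin y * -(r * -sin y)) / (1 - r * cos y) ^ 2) =
        (r * cos y - r ^ 2) / ((1 - r * cos y) ^ 2 + (r * sin y) ^ 2) := by
      have : 1 + (r * sin y / (1 - r * cos y)) ^ 2 =
          ((1 - r * cos y) ^ 2 + (r * sin y) ^ 2) / (1 - r * cos y) ^ 2 := by
        field_simp
      rw [this]
      have hnum : r * cos y * (1 - r * cos y) - r * sin y * -(r * -sin y) =
          r * cos y - r ^ 2 := by nlinarith [sin_sq_add_cos_sq y]
      rw [hnum, one_div_div, div_mul_div_comm, mul_comm, mul_div_mul_right _ _ (pow_ne_zero 2 hd)]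
    simp only [Pi.div_apply]
    rw [e1, hq]
    have hac' := (hac y).ne'
    have hr' := hr0.ne'
    have hs' := hs0.ne'
    rw [div_eq_iff hs', ← sub_eq_zero]
    have : 1 + 2 * ((r * cos y - r ^ 2) / (2 * r * (a - cos y))) - (a - cos y)⁻¹ * s
      = (1 + r ^ 2 - 2 * r ^ 2 - 2 * s * r + (2 * a * r - (1 + r ^ 2))) / (2 * r * (a - cos y)) := by
      field_simp
      ring
    rw [this]
    have : 1 + r ^ 2 - 2 * r ^ 2 - 2 * s * r + (2 * a * r - (1 + r ^ 2)) = 0 := by linarith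
    rw [this, zero_div]
  rw [integral_eq_sub_of_hasDerivAt (fun y _ => hderiv y)]
  · simp
    ring
  · refine ContinuousOn.intervalIntegrable (Continuous.continuousOn ?_)
    exact Continuous.inv₀ (by fun_prop) fun y => (hac y).ne'

/-- The density which arises after integrating out one variable. -/
def outerDensity (x : ℝ) : ℝ := |sin x| * √((1 + cos x) / (3 - cos x))

theorem continuous_outerDensity : Continuous outerDensity := by
  unfold outerDensity
  refine Continuous.mul (by fun_prop) (Continuous.sqrt (Continuous.div (by fun_prop) (by fun_prop)
    fun x => ?_))
  linarith [cos_le_one x]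

/-- The factor 1 - cos x is common to sin² x and to (2 - cos x)² - 1 = (1 - cos x)(3 - cos x). Its
cancellation is what makes the density continuous at x = 0. -/
theorem sin_sq_div_sqrt {x : ℝ} (hx : cos x < 1) :
    sin x ^ 2 / √((2 - cos x) ^ 2 - 1) = outerDensity x := by
  have h1 : 0 ≤ 1 + cos x := by linarith [neg_one_le_cos x]
  have hD : 0 < (2 - cos x) ^ 2 - 1 := by nlinarith
  rw [outerDensity, ← sqrt_sq_eq_abs, ← sqrt_mul (sq_nonneg _), div_eq_iff (sqrt_pos.2 hD).ne',
    ← sqrt_mul (mul_nonneg (sq_nonneg _) (div_nonneg h1 (by linarith)))]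
  refine (sqrt_eq_of_eq_sq ?_ (sq_nonneg _)).symm
  have h3 : 3 - cos x ≠ 0 := by linarith
  rw [sin_sq]
  field_simp
  ring

theorem integral_sin_sq_mul_inv {x : ℝ} (hx : cos x < 1) :
    ∫ y in -π..π, (2 - cos x - cos y)⁻¹ = 2 * π / √((2 - cos x) ^ 2 - 1) :=
  integral_inv_sub_cos (by linarith)

/-- Separates the points where the weight can vanish in y. There the factor sin² x is 0, so the
inner integral formulas hold trivially. -/
theorem cos_eq_one_or_lt (x : ℝ) : sin x = 0 ∧ outerDensity x = 0 ∨ cos x < 1 := by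
  rcases (cos_le_one x).eq_or_lt with h | h
  · left
    have : sin x = 0 := by
      have := sin_sq_add_cos_sq x
      rw [h] at this
      nlinarith
    exact ⟨this, by simp [outerDensity, this]⟩
  · exact Or.inr h

theorem integral_inner_zero (x : ℝ) :
    ∫ y in -π..π, sin x ^ 2 / (4 - 2 * (cos x + cos y)) = π * outerDensity x := by
  rcases cos_eq_one_or_lt x with ⟨h, h'⟩ | h
  · simp [h, h']
  · have h1 : ∀ y, sin x ^ 2 / (4 - 2 * (cos x + cos y)) =
        sin x ^ 2 / 2 * (2 - cos x - cos y)⁻¹ := fun y => by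
      have : 2 - cos x - cos y ≠ 0 := by linarith [cos_le_one y]
      rw [show 4 - 2 * (cos x + cos y) = 2 * (2 - cos x - cos y) by ring]
      field_simp
    simp only [h1]
    rw [intervalIntegral.integral_const_mul, integral_sin_sq_mul_inv h, ← sin_sq_div_sqrt h]
    ring

theorem intervalIntegrable_inner {x : ℝ} (h : cos x < 1) {g : ℝ → ℝ} (hg : Continuous g) :
    IntervalIntegrable (fun y => g y / (4 - 2 * (cos x + cos y))) volume (-π) π := by
  refine (Continuous.div hg (by fun_prop) fun y => ?_).intervalIntegrable _ _
  linarith [cos_le_one y]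

theorem integral_cos_pi : ∫ y in -π..π, cos y = 0 := by simp

/-- Dividing cos y by the weight with remainder lowers the power of cos y by one. The same reduction
gives the square from this case. -/
theorem integral_inner_one (x : ℝ) :
    ∫ y in -π..π, sin x ^ 2 * cos y / (4 - 2 * (cos x + cos y)) =
      (2 - cos x) * (π * outerDensity x) - π * sin x ^ 2 := by
  rcases cos_eq_one_or_lt x with ⟨h, h'⟩ | h
  · simp [h, h']
  · have h1 : ∀ y, sin x ^ 2 * cos y / (4 - 2 * (cos x + cos y)) =
        (2 - cos x) * (sin x ^ 2 / (4 - 2 * (cos x + cos y))) - sin x ^ 2 / 2 := fun y => by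
      have : 4 - 2 * (cos x + cos y) ≠ 0 := by linarith [cos_le_one y]
      field_simp
      ring
    simp only [h1]
    rw [intervalIntegral.integral_sub
      ((intervalIntegrable_inner h continuous_const).const_mul _) (by simp),
      intervalIntegral.integral_const_mul, integral_inner_zero, intervalIntegral.integral_const,
      smul_eq_mul]
    ring

theorem integral_inner_two (x : ℝ) :
    ∫ y in -π..π, sin x ^ 2 * cos y ^ 2 / (4 - 2 * (cos x + cos y)) =
      (2 - cos x) * ((2 - cos x) * (π * outerDensity x) - π * sin x ^ 2) := by
  rcases cos_eq_one_or_lt x with ⟨h, h'⟩ | h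
  · simp [h, h']
  · have h1 : ∀ y, sin x ^ 2 * cos y ^ 2 / (4 - 2 * (cos x + cos y)) =
        (2 - cos x) * (sin x ^ 2 * cos y / (4 - 2 * (cos x + cos y))) -
          sin x ^ 2 / 2 * cos y := fun y => by
      have : 4 - 2 * (cos x + cos y) ≠ 0 := by linarith [cos_le_one y]
      field_simp
      ring
    simp only [h1]
    rw [intervalIntegral.integral_sub
      ((intervalIntegrable_inner h (by fun_prop)).const_mul _)
      ((continuous_cos.intervalIntegrable _ _).const_mul _),
      intervalIntegral.integral_const_mul, integral_inner_one,
      intervalIntegral.integral_const_mul, integral_cos_pi, mul_zero, sub_zero]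

theorem integral_neg_pi_pi_of_even {f : ℝ → ℝ} (hf : Continuous f) (he : ∀ x, f (-x) = f x) :
    ∫ x in -π..π, f x = 2 * ∫ x in 0..π, f x := by
  rw [← integral_add_adjacent_intervals (hf.intervalIntegrable (-π) 0) (hf.intervalIntegrable 0 π)]
  have h : ∫ x in -π..0, f x = ∫ x in 0..π, f x := by
    have := integral_comp_neg (a := -π) (b := 0) f
    simp only [he, neg_zero, neg_neg] at this
    exact this
  rw [h, two_mul]

/-- With u = cos x the integrand on (0, π) becomes u^k (1 + u) / √D, where D = (1 + u)(3 - u). The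
ansatz (αu² + βu + γ)√D + q arcsin((u - 1)/2) is an antiderivative exactly when the polynomial
identity `h` holds, because D' / 2 = 1 - u. At u = 1 one has √D = 2, and at u = -1 only the arcsine
contributes. -/
theorem integral_outerDensity_mul_cos_pow {k : ℕ} {α β γ q : ℝ}
    (h : ∀ u : ℝ, (2 * α * u + β) * ((1 + u) * (3 - u)) + (α * u ^ 2 + β * u + γ) * (1 - u) + q =
      u ^ k * (1 + u)) :
    ∫ x in -π..π, outerDensity x * cos x ^ k = 2 * (q * π / 2 + 2 * (α + β + γ)) := by
  rw [integral_neg_pi_pi_of_even (f := fun x => outerDensity x * cos x ^ k)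
    (continuous_outerDensity.mul (by fun_prop)) (fun x => by simp [outerDensity])]
  congr 1
  have hderiv : ∀ x ∈ Set.Ioo 0 π, HasDerivAt
      (fun x => -((α * cos x ^ 2 + β * cos x + γ) * √((1 + cos x) * (3 - cos x)) +
        q * arcsin ((cos x - 1) / 2))) (outerDensity x * cos x ^ k) x := by
    intro x hx
    have hsin := sin_pos_of_mem_Ioo hx
    have hsq := sin_sq_add_cos_sq x
    have hc1 : -1 < cos x := by nlinarith [neg_one_le_cos x]
    have hc2 : cos x < 1 := by nlinarith [cos_le_one x]
    have hD : 0 < (1 + cos x) * (3 - cos x) := mul_pos (by linarith) (by linarith)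
    have hcos := hasDerivAt_cos x
    have h1 : HasDerivAt (fun x => α * cos x ^ 2 + β * cos x + γ)
        (α * (2 * cos x * -sin x) + β * -sin x) x := by
      have := (((hcos.pow 2).const_mul α).add (hcos.const_mul β)).add_const γ
      refine this.congr_deriv ?_
      simp
    have h2 : HasDerivAt (fun x => √((1 + cos x) * (3 - cos x)))
        ((-sin x * (3 - cos x) + (1 + cos x) * -(-sin x)) / (2 * √((1 + cos x) * (3 - cos x)))) x :=
      ((hcos.const_add 1).mul (hcos.const_sub 3)).sqrt hD.ne'
    have h3 : HasDerivAt (fun x => arcsin ((cos x - 1) / 2))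
        (1 / √(1 - ((cos x - 1) / 2) ^ 2) * (-sin x / 2)) x :=
      HasDerivAt.comp x (hasDerivAt_arcsin (by linarith) (by linarith))
        ((hcos.sub_const 1).div_const 2)
    refine (((h1.mul h2).add (h3.const_mul q)).neg).congr_deriv ?_
    have hr : √(1 - ((cos x - 1) / 2) ^ 2) = √((1 + cos x) * (3 - cos x)) / 2 := by
      rw [show 1 - ((cos x - 1) / 2) ^ 2 = (1 + cos x) * (3 - cos x) / 2 ^ 2 by ring,
        sqrt_div' _ (by norm_num), sqrt_sq (by norm_num)]
    have hd : outerDensity x = sin x * ((1 + cos x) / √((1 + cos x) * (3 - cos x))) := by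
      rw [outerDensity, abs_of_pos hsin]
      congr 1
      refine sqrt_eq_of_eq_sq ?_ (div_nonneg (by linarith) (sqrt_nonneg _))
      rw [div_pow, sq_sqrt hD.le]
      have : 3 - cos x ≠ 0 := by linarith
      have : 1 + cos x ≠ 0 := by linarith
      field_simp
    have hDs := sq_sqrt hD.le
    have hD0 := (sqrt_pos.2 hD).ne'
    rw [hr, hd]
    set D := √((1 + cos x) * (3 - cos x)) with hDdef
    have e1 : sin x * ((1 + cos x) / D) * cos x ^ k = sin x * (cos x ^ k * (1 + cos x)) / D := by
      ring
    rw [e1, ← h (cos x), ← hDs, eq_div_iff hD0]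
    field_simp
    ring
  rw [integral_eq_sub_of_hasDerivAt_of_le pi_pos.le ?_ hderiv
    ((continuous_outerDensity.mul (by fun_prop)).intervalIntegrable _ _)]
  · norm_num [arcsin_neg_one]
    ring
  · exact Continuous.continuousOn (by fun_prop)

theorem integral_outerDensity : ∫ x in -π..π, outerDensity x = 2 * π - 4 := by
  have := integral_outerDensity_mul_cos_pow (k := 0) (α := 0) (β := 0) (γ := -1) (q := 2)
    (fun u => by ring)
  simp only [pow_zero, mul_one] at this
  rw [this]; ring

theorem integral_outerDensity_mul_cos :
    ∫ x in -π..π, outerDensity x * cos x = 4 * π - 12 := by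
  have := integral_outerDensity_mul_cos_pow (k := 1) (α := 0) (β := -1 / 2) (γ := -5 / 2) (q := 4)
    (fun u => by ring)
  simp only [pow_one] at this
  rw [this]; ring

theorem integral_outerDensity_mul_cos_sq :
    ∫ x in -π..π, outerDensity x * cos x ^ 2 = 10 * π - 92 / 3 := by
  rw [integral_outerDensity_mul_cos_pow (k := 2) (α := -1 / 3) (β := -4 / 3) (γ := -6) (q := 10)
    (fun u => by ring)]
  ring

theorem integral_sin_sq_pi : ∫ x in -π..π, sin x ^ 2 = π := by
  rw [integral_sin_sq]; simp

theorem integral_sin_sq_mul_cos_pi : ∫ x in -π..π, sin x ^ 2 * cos x = 0 := by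
  rw [integral_sin_sq_mul_cos]
  simp

theorem integral_comp_cos_neg (f : ℝ → ℝ) :
    ∫ y in -π..π, f (-cos y) = ∫ y in -π..π, f (cos y) := by
  have hper : Function.Periodic (fun y => f (cos y)) (2 * π) := fun y => by simp
  have h1 := hper.intervalIntegral_add_eq (-π) 0
  rw [show -π + 2 * π = π by ring, zero_add] at h1
  rw [h1]
  have h2 := intervalIntegral.integral_comp_add_right (a := -π) (b := π) (fun y => f (cos y)) π
  simp only [cos_add_pi] at h2
  rw [h2]
  congr 1 <;> ring

/-! ### Integrals over the torus and the moments -/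

theorem torus_eq_prod : torus =
    (volume.restrict (Set.Ioc (-π) π)).prod (volume.restrict (Set.Ioc (-π) π)) := by
  rw [torus, Measure.volume_eq_prod, ← Measure.prod_restrict,
    Measure.restrict_congr_set Ico_ae_eq_Ioc]

theorem integral_torus {f : ℝ × ℝ → ℝ} (hf : Integrable f torus) :
    ∫ p, f p ∂torus = ∫ x in -π..π, ∫ y in -π..π, f (x, y) := by
  have hle : -π ≤ π := by linarith [pi_pos]
  rw [torus_eq_prod] at hf ⊢
  rw [integral_prod _ hf, intervalIntegral.integral_of_le hle]
  simp only [intervalIntegral.integral_of_le hle]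

theorem integral_torus_swap (f : ℝ × ℝ → ℝ) :
    ∫ p, f p.swap ∂torus = ∫ p, f p ∂torus := by
  rw [torus_eq_prod]
  exact integral_prod_swap f

/-- An integral over the torus vanishes if the integrand is odd in the first variable. -/
theorem integral_torus_eq_zero {f : ℝ × ℝ → ℝ} (hf : Integrable f torus)
    (hodd : ∀ x y, f (-x, y) = -f (x, y)) : ∫ p, f p ∂torus = 0 := by
  rw [integral_torus hf]
  have h1 := integral_comp_neg (a := -π) (b := π) fun x => ∫ y in -π..π, f (x, y)
  simp only [hodd, intervalIntegral.integral_neg, neg_neg] at h1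
  linarith

/-- The function `4 - 2σ(cos p₁ + cos p₂)`: for `σ = 1` it is `ℰ₀`, for `σ = -1` it is `8 - ℰ₀`. -/
def weight (σ : ℝ) (p : ℝ × ℝ) : ℝ := 4 - 2 * σ * (cos p.1 + cos p.2)

theorem continuous_weight (σ : ℝ) : Continuous (weight σ) := by
  unfold weight
  fun_prop

/-- Write sin² = (1 - cos)(1 + cos) and bound the factor not in the weight by 2. This inequality
compensates the zeros of the weight everywhere: in the moments and in the vectors divided by its
square root. -/
theorem sin_sq_fst_le_weight {σ : ℝ} (hσ : σ = 1 ∨ σ = -1) (p : ℝ × ℝ) :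
    sin p.1 ^ 2 ≤ weight σ p := by
  have h1 := cos_le_one p.1
  have h2 := cos_le_one p.2
  have h3 := neg_one_le_cos p.1
  have h4 := neg_one_le_cos p.2
  rw [sin_sq, weight]
  rcases hσ with rfl | rfl <;> nlinarith

theorem weight_nonneg {σ : ℝ} (hσ : σ = 1 ∨ σ = -1) (p : ℝ × ℝ) : 0 ≤ weight σ p :=
  (sq_nonneg _).trans (sin_sq_fst_le_weight hσ p)

theorem weight_swap (σ : ℝ) (p : ℝ × ℝ) : weight σ p.swap = weight σ p := by
  simp only [weight, Prod.fst_swap, Prod.snd_swap]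
  ring

/-- The integrals of `sin² p₁ cosᵐ p₁ cosⁿ p₂` against the inverse weight. -/
def moment (σ : ℝ) (m n : ℕ) : ℝ :=
  ∫ p, sin p.1 ^ 2 * cos p.1 ^ m * cos p.2 ^ n / weight σ p ∂torus

theorem integrable_moment {σ : ℝ} (hσ : σ = 1 ∨ σ = -1) (m n : ℕ) :
    Integrable (fun p : ℝ × ℝ => sin p.1 ^ 2 * cos p.1 ^ m * cos p.2 ^ n / weight σ p) torus := by
  refine Integrable.of_bound (C := 1) ?_ (Filter.Eventually.of_forall fun p => ?_)
  · exact Measurable.aestronglyMeasurable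
      (Measurable.div (by fun_prop) (continuous_weight σ).measurable)
  · have hw := weight_nonneg hσ p
    rw [norm_eq_abs, abs_div, abs_of_nonneg hw]
    refine div_le_one_of_le₀ (le_trans ?_ (sin_sq_fst_le_weight hσ p)) hw
    rw [abs_mul, abs_mul, abs_pow, abs_pow, abs_pow, sq_abs]
    refine mul_le_of_le_one_right (mul_nonneg (sq_nonneg _) (by positivity))
      (pow_le_one₀ (abs_nonneg _) (abs_cos_le_one _)) |>.trans ?_
    exact mul_le_of_le_one_right (sq_nonneg _) (pow_le_one₀ (abs_nonneg _) (abs_cos_le_one _))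

theorem moment_eq_iterated {σ : ℝ} (hσ : σ = 1 ∨ σ = -1) (m n : ℕ) :
    moment σ m n = ∫ x in -π..π, cos x ^ m *
      ∫ y in -π..π, sin x ^ 2 * cos y ^ n / (4 - 2 * σ * (cos x + cos y)) := by
  rw [moment, integral_torus (integrable_moment hσ m n)]
  simp only [← intervalIntegral.integral_const_mul, weight]
  congr 1
  ext x
  congr 1
  ext y
  ring

/-- Translation by π in both variables turns `weight (-1)` into `weight 1`, leaves sin² alone and
changes the sign of every cosine. -/
theorem moment_neg_one (m n : ℕ) : moment (-1) m n = (-1) ^ (m + n) * moment 1 m n := by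
  rw [moment_eq_iterated (Or.inr rfl), moment_eq_iterated (Or.inl rfl),
    ← intervalIntegral.integral_const_mul]
  have h1 := integral_comp_cos_neg fun u => u ^ m *
      ∫ y in -π..π, (1 - u ^ 2) * cos y ^ n / (4 - 2 * (-1) * (u + cos y))
  simp only [sin_sq]
  rw [← h1]
  congr 1
  ext x
  have h2 := integral_comp_cos_neg fun v =>
    (1 - (-cos x) ^ 2) * v ^ n / (4 - 2 * (-1) * (-cos x + v))
  rw [← h2, ← intervalIntegral.integral_const_mul, ← intervalIntegral.integral_const_mul,
    ← intervalIntegral.integral_const_mul]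
  congr 1
  ext y
  rw [neg_pow (cos x) m, neg_pow (cos y) n, neg_sq,
    show 4 - 2 * -1 * (-cos x + -cos y) = 4 - 2 * 1 * (cos x + cos y) by ring, pow_add]
  ring

theorem moment_one_zero_right (m : ℕ) :
    moment 1 m 0 = π * ∫ x in -π..π, outerDensity x * cos x ^ m := by
  rw [moment_eq_iterated (Or.inl rfl), ← intervalIntegral.integral_const_mul]
  congr 1
  ext x
  simp only [pow_zero, mul_one, integral_inner_zero]
  ring

theorem moment_zero_zero : moment 1 0 0 = π * (2 * π - 4) := by
  rw [moment_one_zero_right]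
  simp only [pow_zero, mul_one, integral_outerDensity]

theorem moment_one_zero : moment 1 1 0 = π * (4 * π - 12) := by
  rw [moment_one_zero_right]
  simp only [pow_one, integral_outerDensity_mul_cos]

theorem moment_two_zero : moment 1 2 0 = π * (10 * π - 92 / 3) := by
  rw [moment_one_zero_right, integral_outerDensity_mul_cos_sq]

theorem intervalIntegrable_outerDensity_mul (g : ℝ → ℝ) (hg : Continuous g) :
    IntervalIntegrable (fun x => outerDensity x * g x) volume (-π) π :=
  (continuous_outerDensity.mul hg).intervalIntegrable _ _

theorem moment_zero_one : moment 1 0 1 = 4 * π - π ^ 2 := by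
  rw [moment_eq_iterated (Or.inl rfl)]
  have h : ∀ x, cos x ^ 0 * (∫ y in -π..π,
      sin x ^ 2 * cos y ^ 1 / (4 - 2 * 1 * (cos x + cos y))) =
      π * (2 * outerDensity x - outerDensity x * cos x) - π * sin x ^ 2 := fun x => by
    simp only [pow_zero, pow_one, one_mul, mul_one, integral_inner_one]
    ring
  simp only [h]
  have i0 : IntervalIntegrable outerDensity volume (-π) π :=
    continuous_outerDensity.intervalIntegrable _ _
  have i1 := intervalIntegrable_outerDensity_mul cos continuous_cos
  have i2 : IntervalIntegrable (fun x => π * sin x ^ 2) volume (-π) π :=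
    Continuous.intervalIntegrable (by fun_prop) _ _
  rw [intervalIntegral.integral_sub (((i0.const_mul 2).sub i1).const_mul π) i2,
    intervalIntegral.integral_const_mul, intervalIntegral.integral_sub (i0.const_mul 2) i1,
    intervalIntegral.integral_const_mul, intervalIntegral.integral_const_mul,
    integral_outerDensity, integral_outerDensity_mul_cos, integral_sin_sq_pi]
  ring

theorem moment_one_one : moment 1 1 1 = 20 / 3 * π - 2 * π ^ 2 := by
  rw [moment_eq_iterated (Or.inl rfl)]
  have h : ∀ x, cos x ^ 1 * (∫ y in -π..π,
      sin x ^ 2 * cos y ^ 1 / (4 - 2 * 1 * (cos x + cos y))) =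
      π * (2 * (outerDensity x * cos x) - outerDensity x * cos x ^ 2) -
        π * (sin x ^ 2 * cos x) := fun x => by
    simp only [pow_one, mul_one, integral_inner_one]
    ring
  simp only [h]
  have i1 := intervalIntegrable_outerDensity_mul cos continuous_cos
  have i2 := intervalIntegrable_outerDensity_mul (fun x => cos x ^ 2) (by fun_prop)
  have i3 : IntervalIntegrable (fun x => π * (sin x ^ 2 * cos x)) volume (-π) π :=
    Continuous.intervalIntegrable (by fun_prop) _ _
  rw [intervalIntegral.integral_sub (((i1.const_mul 2).sub i2).const_mul π) i3,
    intervalIntegral.integral_const_mul, intervalIntegral.integral_sub (i1.const_mul 2) i2,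
    intervalIntegral.integral_const_mul, intervalIntegral.integral_const_mul,
    integral_outerDensity_mul_cos, integral_outerDensity_mul_cos_sq, integral_sin_sq_mul_cos_pi]
  ring

theorem moment_zero_two : moment 1 0 2 = 4 / 3 * π := by
  rw [moment_eq_iterated (Or.inl rfl)]
  have h : ∀ x, cos x ^ 0 * (∫ y in -π..π,
      sin x ^ 2 * cos y ^ 2 / (4 - 2 * 1 * (cos x + cos y))) =
      π * (4 * outerDensity x - 4 * (outerDensity x * cos x) + outerDensity x * cos x ^ 2) -
        π * (2 * sin x ^ 2 - sin x ^ 2 * cos x) := fun x => by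
    simp only [pow_zero, one_mul, mul_one, integral_inner_two]
    ring
  simp only [h]
  have i0 : IntervalIntegrable outerDensity volume (-π) π :=
    continuous_outerDensity.intervalIntegrable _ _
  have i1 := intervalIntegrable_outerDensity_mul cos continuous_cos
  have i2 := intervalIntegrable_outerDensity_mul (fun x => cos x ^ 2) (by fun_prop)
  have i3 : IntervalIntegrable (fun x => sin x ^ 2) volume (-π) π :=
    Continuous.intervalIntegrable (by fun_prop) _ _
  have i4 : IntervalIntegrable (fun x => sin x ^ 2 * cos x) volume (-π) π :=
    Continuous.intervalIntegrable (by fun_prop) _ _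
  rw [intervalIntegral.integral_sub ((((i0.const_mul 4).sub (i1.const_mul 4)).add i2).const_mul π)
      (((i3.const_mul 2).sub i4).const_mul π),
    intervalIntegral.integral_const_mul,
    intervalIntegral.integral_add ((i0.const_mul 4).sub (i1.const_mul 4)) i2,
    intervalIntegral.integral_sub (i0.const_mul 4) (i1.const_mul 4),
    intervalIntegral.integral_const_mul, intervalIntegral.integral_const_mul,
    intervalIntegral.integral_const_mul, intervalIntegral.integral_sub (i3.const_mul 2) i4,
    intervalIntegral.integral_const_mul,
    integral_outerDensity, integral_outerDensity_mul_cos, integral_outerDensity_mul_cos_sq,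
    integral_sin_sq_pi, integral_sin_sq_mul_cos_pi]
  ring

end Integrals

/-! ## The components of the parameter plane -/

section Components

/-- A connected subset of `U` meeting the open set `C k` cannot leave it, since the union of the
other pieces is also open and disjoint from it. -/
theorem areComponents_of_cover {U : Set (ℝ × ℝ)} {C : Fin 4 → Set (ℝ × ℝ)}
    (hopen : ∀ k, IsOpen (C k)) (hconn : ∀ k, IsPreconnected (C k)) (hne : ∀ k, (C k).Nonempty)
    (hdisj : Pairwise fun i j => Disjoint (C i) (C j)) (hU : U = ⋃ k, C k) :
    AreComponents U C := by
  have hcomp : ∀ k, ∀ x ∈ C k, connectedComponentIn U x = C k := by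
    intro k x hx
    have hsub : C k ⊆ U := hU ▸ Set.subset_iUnion C k
    refine Set.Subset.antisymm ?_ ((hconn k).subset_connectedComponentIn hx hsub)
    have hsplit : U ⊆ C k ∪ ⋃ j ∈ {j | j ≠ k}, C j := by
      rw [hU]
      refine Set.iUnion_subset fun j => ?_
      by_cases h : j = k
      · subst h; exact Set.subset_union_left
      · exact Set.subset_union_of_subset_right (Set.subset_biUnion_of_mem (u := C) h) _
    refine isPreconnected_connectedComponentIn.subset_left_of_subset_union (hopen k)
      (isOpen_biUnion fun j _ => hopen j) ?_
      ((connectedComponentIn_subset U x).trans hsplit)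
      ⟨x, mem_connectedComponentIn (hsub hx), hx⟩
    rw [Set.disjoint_iUnion₂_right]
    exact fun j hj => hdisj (Ne.symm hj)
  refine ⟨fun i j hij => ?_, ?_⟩
  · by_contra h
    obtain ⟨x, hx⟩ := hne i
    exact Set.disjoint_left.1 (hdisj h) hx (hij ▸ hx)
  · ext S
    constructor
    · rintro ⟨k, rfl⟩
      obtain ⟨x, hx⟩ := hne k
      exact ⟨x, hU ▸ Set.mem_iUnion_of_mem k hx, (hcomp k x hx).symm⟩
    · rintro ⟨x, hx, rfl⟩
      rw [hU] at hx
      obtain ⟨k, hk⟩ := Set.mem_iUnion.1 hx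
      exact ⟨k, (hcomp k x hk).symm⟩

/-- The polynomial in `(λ, μ)` whose zero set is the curve `C⁻ = 0`. -/
def curvePoly (x : ℝ × ℝ) : ℝ :=
  8 * ((x.2 - mu0p) * (x.2 - mu0m)) + x.1 * ((x.2 - mu1p) * (x.2 - mu1m))

theorem continuous_curvePoly : Continuous curvePoly := by
  unfold curvePoly
  fun_prop

/-- The discriminants and the leading coefficient are small differences of large terms, so many
digits are needed. Bounding the powers separately makes most later estimates linear. -/
theorem pi_bounds : 3.14159265 < Real.pi ∧ Real.pi < 3.14159266 ∧
    9.86960435 < Real.pi ^ 2 ∧ Real.pi ^ 2 < 9.86960447 ∧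
    31.0062765 < Real.pi ^ 3 ∧ Real.pi ^ 3 < 31.0062770 ∧
    97.409090 < Real.pi ^ 4 ∧ Real.pi ^ 4 < 97.409092 := by
  have h1 : (3.14159265 : ℝ) < Real.pi := lt_trans (by norm_num) Real.pi_gt_d20
  have h2 : Real.pi < (3.14159266 : ℝ) := lt_trans Real.pi_lt_d20 (by norm_num)
  have hl : ∀ n : ℕ, n ≠ 0 → (3.14159265 : ℝ) ^ n < Real.pi ^ n := fun n hn =>
    pow_lt_pow_left₀ h1 (by norm_num) hn
  have hu : ∀ n : ℕ, n ≠ 0 → Real.pi ^ n < (3.14159266 : ℝ) ^ n := fun n hn =>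
    pow_lt_pow_left₀ h2 Real.pi_pos.le hn
  refine ⟨h1, h2, lt_of_lt_of_le ?_ (hl 2 (by norm_num)).le, lt_of_le_of_lt (hu 2 (by norm_num)).le ?_,
    lt_of_lt_of_le ?_ (hl 3 (by norm_num)).le, lt_of_le_of_lt (hu 3 (by norm_num)).le ?_,
    lt_of_lt_of_le ?_ (hl 4 (by norm_num)).le, lt_of_le_of_lt (hu 4 (by norm_num)).le ?_⟩ <;>
    norm_num

theorem sqrt_disc0_bounds :
    2.89 < √(1044 * Real.pi ^ 2 - 6720 * Real.pi + 10816) ∧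
      √(1044 * Real.pi ^ 2 - 6720 * Real.pi + 10816) < 2.91 := by
  obtain ⟨h1, h2, h3, h4, -⟩ := pi_bounds
  exact ⟨Real.lt_sqrt_of_sq_lt (by linarith), (Real.sqrt_lt' (by norm_num)).2 (by linarith)⟩

theorem sqrt_disc1_bounds :
    3.60 < √(225 * Real.pi ^ 4 - 1440 * Real.pi ^ 3 + 3904 * Real.pi ^ 2 - 10240 * Real.pi
        + 16384) ∧
      √(225 * Real.pi ^ 4 - 1440 * Real.pi ^ 3 + 3904 * Real.pi ^ 2 - 10240 * Real.pi
        + 16384) < 3.62 := by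
  obtain ⟨h1, h2, h3, h4, h5, h6, h7, h8⟩ := pi_bounds
  exact ⟨Real.lt_sqrt_of_sq_lt (by linarith), (Real.sqrt_lt' (by norm_num)).2 (by linarith)⟩

theorem curve_const_pos : 0 < 30 * Real.pi - 3 * Real.pi ^ 2 - 64 := by
  obtain ⟨h1, h2, h3, h4, -⟩ := pi_bounds
  linarith

/-- Together with the next three bounds this gives μ₁⁻ < μ₀⁻ < μ₁⁺ < μ₀⁺. The tight spot is between
μ₁⁻ and μ₀⁻, separated by -5.7 and -5.68. -/
theorem mu0p_gt : -2.1 < mu0p := by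
  obtain ⟨h1, h2, h3, h4, -⟩ := pi_bounds
  obtain ⟨h5, h6⟩ := sqrt_disc0_bounds
  rw [mu0p, div_mul_eq_mul_div, lt_div_iff₀ (by linarith)]
  nlinarith

theorem mu0m_mem : -5.68 < mu0m ∧ mu0m < -5.5 := by
  obtain ⟨h1, h2, h3, h4, -⟩ := pi_bounds
  obtain ⟨h5, h6⟩ := sqrt_disc0_bounds
  rw [mu0m, div_mul_eq_mul_div, lt_div_iff₀ (by linarith), div_lt_iff₀ (by linarith)]
  constructor <;> nlinarith

theorem mu1p_mem : -3 < mu1p ∧ mu1p < -2.8 := by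
  obtain ⟨h1, h2, h3, h4, -⟩ := pi_bounds
  obtain ⟨h5, h6⟩ := sqrt_disc1_bounds
  rw [mu1p, lt_div_iff₀ (by linarith), div_lt_iff₀ (by linarith)]
  constructor <;> linarith

theorem mu1m_lt : mu1m < -5.7 := by
  obtain ⟨h1, h2, h3, h4, -⟩ := pi_bounds
  obtain ⟨h5, h6⟩ := sqrt_disc1_bounds
  rw [mu1m, div_lt_iff₀ (by linarith)]
  linarith

theorem mu1m_lt_mu1p : mu1m < mu1p := by linarith [mu1m_lt, mu1p_mem.1]

/-- On this line the coefficient of λ vanishes, so the sign is that of the remaining quadratic, and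
μ₁⁺ lies between its roots. On the other line, μ₁⁻ lies below both roots. -/
theorem curvePoly_mu1p (t : ℝ) : curvePoly (t, mu1p) < 0 := by
  have h1 : mu1p - mu0p < 0 := by linarith [mu1p_mem.2, mu0p_gt]
  have h2 : 0 < mu1p - mu0m := by linarith [mu1p_mem.1, mu0m_mem.2]
  have := mul_neg_of_neg_of_pos h1 h2
  simp only [curvePoly, sub_self, zero_mul, mul_zero, add_zero]
  linarith

theorem curvePoly_mu1m (t : ℝ) : 0 < curvePoly (t, mu1m) := by
  have h1 : mu1m - mu0p < 0 := by linarith [mu1m_lt, mu0p_gt]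
  have h2 : mu1m - mu0m < 0 := by linarith [mu1m_lt, mu0m_mem.1]
  have := mul_pos_of_neg_of_neg h1 h2
  simp only [curvePoly, sub_self, mul_zero, add_zero]
  linarith

theorem cMinus_eq_curvePoly (x : ℝ × ℝ) :
    cMinus x.1 x.2 =
      (30 * Real.pi - 3 * Real.pi ^ 2 - 64) / (6 * Real.pi ^ 2) * curvePoly x := by
  rw [cMinus, curvePoly]
  ring

theorem curve_factor_pos : 0 < (30 * Real.pi - 3 * Real.pi ^ 2 - 64) / (6 * Real.pi ^ 2) :=
  div_pos curve_const_pos (by positivity)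

theorem cMinus_ne_zero_iff (x : ℝ × ℝ) : cMinus x.1 x.2 ≠ 0 ↔ curvePoly x ≠ 0 := by
  rw [cMinus_eq_curvePoly, mul_ne_zero_iff]
  simp [curve_factor_pos.ne']

theorem curvePoly_eq_mul {x : ℝ × ℝ} (h : (x.2 - mu1p) * (x.2 - mu1m) ≠ 0) :
    curvePoly x = (x.1 - curveMinus x.2) * ((x.2 - mu1p) * (x.2 - mu1m)) := by
  rw [sub_mul, curveMinus, div_mul_cancel₀ _ h, curvePoly]
  ring

theorem curvePoly_pos_iff {x : ℝ × ℝ} (h : 0 < (x.2 - mu1p) * (x.2 - mu1m)) :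
    0 < curvePoly x ↔ curveMinus x.2 < x.1 := by
  rw [curvePoly_eq_mul h.ne', mul_pos_iff_of_pos_right h, sub_pos]

theorem curvePoly_neg_iff {x : ℝ × ℝ} (h : 0 < (x.2 - mu1p) * (x.2 - mu1m)) :
    curvePoly x < 0 ↔ x.1 < curveMinus x.2 := by
  rw [curvePoly_eq_mul h.ne', mul_neg_iff]
  simp [h, h.not_gt]

theorem curvePoly_pos_iff' {x : ℝ × ℝ} (h : (x.2 - mu1p) * (x.2 - mu1m) < 0) :
    0 < curvePoly x ↔ x.1 < curveMinus x.2 := by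
  rw [curvePoly_eq_mul h.ne, mul_pos_iff]
  simp [h, h.not_gt]

theorem curvePoly_neg_iff' {x : ℝ × ℝ} (h : (x.2 - mu1p) * (x.2 - mu1m) < 0) :
    curvePoly x < 0 ↔ curveMinus x.2 < x.1 := by
  rw [curvePoly_eq_mul h.ne, mul_neg_iff]
  simp [h, h.not_gt]

theorem prod_pos_of_gt {m : ℝ} (h : mu1p < m) : 0 < (m - mu1p) * (m - mu1m) :=
  mul_pos (by linarith) (by linarith [mu1m_lt_mu1p])

theorem prod_pos_of_lt {m : ℝ} (h : m < mu1m) : 0 < (m - mu1p) * (m - mu1m) :=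
  mul_pos_of_neg_of_neg (by linarith [mu1m_lt_mu1p]) (by linarith)

theorem prod_neg_of_mem {m : ℝ} (h1 : mu1m < m) (h2 : m < mu1p) :
    (m - mu1p) * (m - mu1m) < 0 :=
  mul_neg_of_neg_of_pos (by linarith) (by linarith)

theorem compMinus_zero : compMinus 0 = {x | 0 < curvePoly x ∧ mu1p < x.2} := by
  ext x
  refine and_congr_left fun h => (curvePoly_pos_iff (prod_pos_of_gt h)).symm

theorem compMinus_three : compMinus 3 = {x | curvePoly x < 0 ∧ x.2 < mu1m} := by
  ext x
  refine and_congr_left fun h => (curvePoly_neg_iff (prod_pos_of_lt h)).symm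

/-- The coefficient of λ changes sign at μ₁⁺, so the same sign of `curvePoly` means one side of the
graph above the line and the other side beneath it. On the line itself that sign holds for every λ,
which glues the three pieces into one sign region. `compMinus_two` is the analogue at μ₁⁻. -/
theorem compMinus_one : compMinus 1 = {x | curvePoly x < 0 ∧ mu1m < x.2} := by
  ext ⟨l, m⟩
  have hlt := mu1m_lt_mu1p
  simp only [compMinus, Set.mem_union, Set.mem_ofPred_eq]
  rcases lt_trichotomy m mu1p with h | h | h
  · constructor
    · rintro ((⟨-, h'⟩ | h') | ⟨h1, h2, -⟩)
      · linarith
      · linarith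
      · exact ⟨(curvePoly_neg_iff' (x := (l, m)) (prod_neg_of_mem h2 h)).2 h1, h2⟩
    · rintro ⟨h1, h2⟩
      exact Or.inr ⟨(curvePoly_neg_iff' (x := (l, m)) (prod_neg_of_mem h2 h)).1 h1, h2, h⟩
  · subst h
    exact ⟨fun _ => ⟨curvePoly_mu1p l, hlt⟩, fun _ => Or.inl (Or.inr rfl)⟩
  · constructor
    · rintro ((⟨h1, -⟩ | h') | ⟨-, -, h'⟩)
      · exact ⟨(curvePoly_neg_iff (x := (l, m)) (prod_pos_of_gt h)).2 h1, by linarith⟩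
      · linarith
      · linarith
    · rintro ⟨h1, -⟩
      exact Or.inl (Or.inl ⟨(curvePoly_neg_iff (x := (l, m)) (prod_pos_of_gt h)).1 h1, h⟩)

theorem compMinus_two : compMinus 2 = {x | 0 < curvePoly x ∧ x.2 < mu1p} := by
  ext ⟨l, m⟩
  have hlt := mu1m_lt_mu1p
  simp only [compMinus, Set.mem_union, Set.mem_ofPred_eq]
  rcases lt_trichotomy m mu1m with h | h | h
  · constructor
    · rintro ((⟨-, h', -⟩ | h') | ⟨h1, -⟩)
      · linarith
      · linarith
      · exact ⟨(curvePoly_pos_iff (x := (l, m)) (prod_pos_of_lt h)).2 h1, by linarith⟩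
    · rintro ⟨h1, -⟩
      exact Or.inr ⟨(curvePoly_pos_iff (x := (l, m)) (prod_pos_of_lt h)).1 h1, h⟩
  · subst h
    exact ⟨fun _ => ⟨curvePoly_mu1m l, hlt⟩, fun _ => Or.inl (Or.inr rfl)⟩
  · constructor
    · rintro ((⟨h1, -, h2⟩ | h') | ⟨-, h'⟩)
      · exact ⟨(curvePoly_pos_iff' (x := (l, m)) (prod_neg_of_mem h h2)).2 h1, h2⟩
      · linarith
      · linarith
    · rintro ⟨h1, h2⟩
      exact Or.inl (Or.inl
        ⟨(curvePoly_pos_iff' (x := (l, m)) (prod_neg_of_mem h h2)).1 h1, h, h2⟩)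

theorem isOpen_compMinus (k : Fin 4) : IsOpen (compMinus k) := by
  have hc := continuous_curvePoly
  fin_cases k
  · exact compMinus_zero ▸ (isOpen_lt continuous_const hc).inter
      (isOpen_lt continuous_const continuous_snd)
  · exact compMinus_one ▸ (isOpen_lt hc continuous_const).inter
      (isOpen_lt continuous_const continuous_snd)
  · exact compMinus_two ▸ (isOpen_lt continuous_const hc).inter
      (isOpen_lt continuous_snd continuous_const)
  · exact compMinus_three ▸ (isOpen_lt hc continuous_const).inter
      (isOpen_lt continuous_snd continuous_const)

theorem cover_compMinus : {x : ℝ × ℝ | cMinus x.1 x.2 ≠ 0} = ⋃ k, compMinus k := by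
  ext ⟨l, m⟩
  rw [Set.mem_ofPred_eq, cMinus_ne_zero_iff, Set.mem_iUnion]
  have hlt := mu1m_lt_mu1p
  constructor
  · intro h
    rcases lt_or_gt_of_ne h with h | h
    · rcases lt_trichotomy m mu1m with hm | hm | hm
      · exact ⟨3, compMinus_three ▸ ⟨h, hm⟩⟩
      · subst hm; linarith [curvePoly_mu1m l]
      · exact ⟨1, compMinus_one ▸ ⟨h, hm⟩⟩
    · rcases lt_trichotomy m mu1p with hm | hm | hm
      · exact ⟨2, compMinus_two ▸ ⟨h, hm⟩⟩
      · subst hm; linarith [curvePoly_mu1p l]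
      · exact ⟨0, compMinus_zero ▸ ⟨h, hm⟩⟩
  · rintro ⟨k, hk⟩
    fin_cases k
    · exact (compMinus_zero.le hk).1.ne'
    · exact (compMinus_one.le hk).1.ne
    · exact (compMinus_two.le hk).1.ne'
    · exact (compMinus_three.le hk).1.ne

theorem disjoint_compMinus : Pairwise fun i j => Disjoint (compMinus i) (compMinus j) := by
  have hlt := mu1m_lt_mu1p
  suffices h : ∀ i j, i < j → Disjoint (compMinus i) (compMinus j) from fun i j hij =>
    (lt_or_gt_of_ne hij).elim (h i j) fun hji => (h j i hji).symm
  intro i j hij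
  rw [Set.disjoint_left]
  intro x hi hj
  fin_cases i <;> fin_cases j <;> first | exact absurd hij (by decide) | skip
  · linarith [(compMinus_zero.le hi).1, (compMinus_one.le hj).1]
  · linarith [(compMinus_zero.le hi).2, (compMinus_two.le hj).2]
  · linarith [(compMinus_zero.le hi).1, (compMinus_three.le hj).1]
  · linarith [(compMinus_one.le hi).1, (compMinus_two.le hj).1]
  · linarith [(compMinus_one.le hi).2, (compMinus_three.le hj).2]
  · linarith [(compMinus_two.le hi).1, (compMinus_three.le hj).1]

theorem continuousOn_curveMinus {s : Set ℝ} (h : ∀ m ∈ s, (m - mu1p) * (m - mu1m) ≠ 0) :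
    ContinuousOn curveMinus s := by
  unfold curveMinus
  exact ContinuousOn.div (by fun_prop) (by fun_prop) h

/-- A shear along the graph identifies the region with the product of a half-line and `s`. -/
theorem isPreconnected_above {s : Set ℝ} (hs : IsPreconnected s)
    (h : ∀ m ∈ s, (m - mu1p) * (m - mu1m) ≠ 0) :
    IsPreconnected {x : ℝ × ℝ | curveMinus x.2 < x.1 ∧ x.2 ∈ s} := by
  have h1 : {x : ℝ × ℝ | curveMinus x.2 < x.1 ∧ x.2 ∈ s} =
      (fun y : ℝ × ℝ => (curveMinus y.2 + y.1, y.2)) '' (Set.Ioi 0 ×ˢ s) := by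
    ext ⟨l, m⟩
    constructor
    · rintro ⟨h1, h2⟩
      exact ⟨(l - curveMinus m, m), ⟨sub_pos.2 h1, h2⟩, by simp⟩
    · rintro ⟨⟨t, n⟩, ⟨h1, h2⟩, h3⟩
      obtain ⟨rfl, rfl⟩ := Prod.mk.inj h3
      exact ⟨lt_add_of_pos_right _ h1, h2⟩
  rw [h1]
  refine (isPreconnected_Ioi.prod hs).image _ (ContinuousOn.prodMk
    (ContinuousOn.add ((continuousOn_curveMinus h).comp continuousOn_snd fun y hy => hy.2)
      continuousOn_fst) continuousOn_snd)

theorem isPreconnected_below {s : Set ℝ} (hs : IsPreconnected s)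
    (h : ∀ m ∈ s, (m - mu1p) * (m - mu1m) ≠ 0) :
    IsPreconnected {x : ℝ × ℝ | x.1 < curveMinus x.2 ∧ x.2 ∈ s} := by
  have h1 : {x : ℝ × ℝ | x.1 < curveMinus x.2 ∧ x.2 ∈ s} =
      (fun y : ℝ × ℝ => (curveMinus y.2 - y.1, y.2)) '' (Set.Ioi 0 ×ˢ s) := by
    ext ⟨l, m⟩
    constructor
    · rintro ⟨h1, h2⟩
      exact ⟨(curveMinus m - l, m), ⟨sub_pos.2 h1, h2⟩, by simp⟩
    · rintro ⟨⟨t, n⟩, ⟨h1, h2⟩, h3⟩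
      obtain ⟨rfl, rfl⟩ := Prod.mk.inj h3
      exact ⟨sub_lt_self _ h1, h2⟩
  rw [h1]
  refine (isPreconnected_Ioi.prod hs).image _ (ContinuousOn.prodMk
    (ContinuousOn.sub ((continuousOn_curveMinus h).comp continuousOn_snd fun y hy => hy.2)
      continuousOn_fst) continuousOn_snd)

/-- A horizontal line lies in the closure of the part of one of its open neighbourhoods which is
adjacent to it. -/
theorem line_subset_closure {a : ℝ} {s : Set (ℝ × ℝ)} {t : Set ℝ} {U : Set (ℝ × ℝ)}
    (hU : IsOpen U) (hline : ∀ l, (l, a) ∈ U) (ht : a ∈ closure t)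
    (hs : ∀ x ∈ U, x.2 ∈ t → x ∈ s) : {x : ℝ × ℝ | x.2 = a} ⊆ closure s := by
  rintro ⟨l, m⟩ rfl
  have h1 : IsOpen ((fun m => (l, m)) ⁻¹' U) := hU.preimage (by fun_prop)
  have h2 : m ∈ closure ((fun m => (l, m)) ⁻¹' U ∩ t) :=
    h1.inter_closure ⟨hline l, ht⟩
  have h3 := image_closure_subset_closure_image (f := fun m : ℝ => (l, m)) (by fun_prop)
    (Set.mem_image_of_mem _ h2)
  refine closure_mono ?_ h3
  rintro _ ⟨n, ⟨hn, hnt⟩, rfl⟩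
  exact hs _ hn hnt

/-- Adding limit points preserves connectedness, and the two enlarged sets share the line. -/
theorem isPreconnected_union_line {a : ℝ} {A B : Set (ℝ × ℝ)} (hA : IsPreconnected A)
    (hB : IsPreconnected B) (hAc : {x : ℝ × ℝ | x.2 = a} ⊆ closure A)
    (hBc : {x : ℝ × ℝ | x.2 = a} ⊆ closure B) : IsPreconnected (A ∪ {x | x.2 = a} ∪ B) := by
  have h1 : IsPreconnected (A ∪ {x : ℝ × ℝ | x.2 = a}) :=
    hA.subset_closure Set.subset_union_left (Set.union_subset subset_closure hAc)
  have h2 : IsPreconnected (B ∪ {x : ℝ × ℝ | x.2 = a}) :=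
    hB.subset_closure Set.subset_union_left (Set.union_subset subset_closure hBc)
  have h3 := IsPreconnected.union ((0 : ℝ), a) (Or.inr rfl) (Or.inr rfl) h1 h2
  convert h3 using 1
  ext x
  simp only [Set.mem_union]
  tauto

theorem isPreconnected_compMinus (k : Fin 4) : IsPreconnected (compMinus k) := by
  have hlt := mu1m_lt_mu1p
  have hneg : IsOpen {x | curvePoly x < 0} := isOpen_lt continuous_curvePoly continuous_const
  have hpos : IsOpen {x | 0 < curvePoly x} := isOpen_lt continuous_const continuous_curvePoly
  have hgt : ∀ m ∈ Set.Ioi mu1p, (m - mu1p) * (m - mu1m) ≠ 0 := fun m hm =>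
    (prod_pos_of_gt hm).ne'
  have hmid : ∀ m ∈ Set.Ioo mu1m mu1p, (m - mu1p) * (m - mu1m) ≠ 0 := fun m hm =>
    (prod_neg_of_mem hm.1 hm.2).ne
  have hlow : ∀ m ∈ Set.Iio mu1m, (m - mu1p) * (m - mu1m) ≠ 0 := fun m hm =>
    (prod_pos_of_lt hm).ne'
  fin_cases k
  · exact isPreconnected_above isPreconnected_Ioi hgt
  · refine isPreconnected_union_line (isPreconnected_below isPreconnected_Ioi hgt)
      (isPreconnected_above isPreconnected_Ioo hmid)
      (line_subset_closure (t := Set.Ioi mu1p) hneg curvePoly_mu1p (by simp) ?_)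
      (line_subset_closure (t := Set.Ioo mu1m mu1p) hneg curvePoly_mu1p ?_ ?_)
    · exact fun x hx hm => ⟨(curvePoly_neg_iff (prod_pos_of_gt hm)).1 hx, hm⟩
    · rw [closure_Ioo hlt.ne]; exact Set.right_mem_Icc.2 hlt.le
    · exact fun x hx hm => ⟨(curvePoly_neg_iff' (prod_neg_of_mem hm.1 hm.2)).1 hx, hm⟩
  · refine isPreconnected_union_line (isPreconnected_below isPreconnected_Ioo hmid)
      (isPreconnected_above isPreconnected_Iio hlow)
      (line_subset_closure (t := Set.Ioo mu1m mu1p) hpos curvePoly_mu1m ?_ ?_)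
      (line_subset_closure (t := Set.Iio mu1m) hpos curvePoly_mu1m (by simp) ?_)
    · rw [closure_Ioo hlt.ne]; exact Set.left_mem_Icc.2 hlt.le
    · exact fun x hx hm => ⟨(curvePoly_pos_iff' (prod_neg_of_mem hm.1 hm.2)).1 hx, hm⟩
    · exact fun x hx hm => ⟨(curvePoly_pos_iff (prod_pos_of_lt hm)).1 hx, hm⟩
  · exact isPreconnected_below isPreconnected_Iio hlow

theorem nonempty_compMinus (k : Fin 4) : (compMinus k).Nonempty := by
  fin_cases k
  · exact ⟨(curveMinus (mu1p + 1) + 1, mu1p + 1), lt_add_one _, lt_add_one _⟩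
  · exact ⟨(0, mu1p), Or.inl (Or.inr rfl)⟩
  · exact ⟨(0, mu1m), Or.inl (Or.inr rfl)⟩
  · exact ⟨(curveMinus (mu1m - 1) - 1, mu1m - 1), sub_one_lt _, sub_one_lt _⟩

theorem areComponents_compMinus :
    AreComponents {x : ℝ × ℝ | cMinus x.1 x.2 ≠ 0} compMinus :=
  areComponents_of_cover isOpen_compMinus isPreconnected_compMinus nonempty_compMinus
    disjoint_compMinus cover_compMinus

theorem cPlus_eq_cMinus_neg (lam mu : ℝ) : cPlus lam mu = cMinus (-lam) (-mu) := by
  rw [cPlus, cMinus]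
  ring

theorem curvePlus_eq_neg_curveMinus (mu : ℝ) : curvePlus mu = -curveMinus (-mu) := by
  rw [curvePlus, curveMinus, ← neg_div, neg_neg]
  congr 1 <;> ring

/-- The reflection (λ, μ) ↦ (-λ, -μ) transfers all statements about the `+` sets from the `-` sets.
-/
theorem compPlus_eq_neg_preimage (k : Fin 4) :
    compPlus k = (fun x : ℝ × ℝ => -x) ⁻¹' compMinus k := by
  ext ⟨l, m⟩
  fin_cases k <;>
    simp [compPlus, compMinus, curvePlus_eq_neg_curveMinus, lt_neg, neg_lt, neg_eq_iff_eq_neg]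
  all_goals tauto

theorem areComponents_compPlus :
    AreComponents {x : ℝ × ℝ | cPlus x.1 x.2 ≠ 0} compPlus := by
  have hc : Continuous fun x : ℝ × ℝ => -x := continuous_neg
  have himg : ∀ k, compPlus k = (fun x : ℝ × ℝ => -x) '' compMinus k := fun k => by
    rw [compPlus_eq_neg_preimage, Set.image_neg_eq_neg]; rfl
  refine areComponents_of_cover (fun k => ?_) (fun k => ?_) (fun k => ?_) (fun i j hij => ?_) ?_
  · exact compPlus_eq_neg_preimage k ▸ (isOpen_compMinus k).preimage hc
  · exact himg k ▸ (isPreconnected_compMinus k).image _ hc.continuousOn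
  · exact himg k ▸ (nonempty_compMinus k).image _
  · simp only [compPlus_eq_neg_preimage]
    exact (disjoint_compMinus hij).preimage _
  · have h1 := congrArg (fun s => (fun x : ℝ × ℝ => -x) ⁻¹' s) cover_compMinus
    simp only [Set.preimage_iUnion, ← compPlus_eq_neg_preimage] at h1
    rw [← h1]
    ext x
    simp [cPlus_eq_cMinus_neg]

end Components

/-! ## Multiplication operators on the odd functions -/

section Operators

open scoped InnerProductSpace

theorem oddL2_ext {f g : oddL2} (h : (f : Lp ℂ 2 torus) =ᵐ[torus] (g : Lp ℂ 2 torus)) : f = g :=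
  Subtype.ext (Lp.ext h)

/-- The half-open square is not symmetric, but it differs by a null set from the closed square,
which is. -/
theorem measurePreserving_neg_torus :
    MeasurePreserving (fun p : ℝ × ℝ => -p) torus torus := by
  have h1 : torus = volume.restrict
      (Set.Icc (-Real.pi) Real.pi ×ˢ Set.Icc (-Real.pi) Real.pi) := by
    rw [torus, Measure.volume_eq_prod, ← Measure.prod_restrict, ← Measure.prod_restrict,
      Measure.restrict_congr_set Ico_ae_eq_Icc]
  have hs : (fun p : ℝ × ℝ => -p) ⁻¹'
      (Set.Icc (-Real.pi) Real.pi ×ˢ Set.Icc (-Real.pi) Real.pi) =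
      Set.Icc (-Real.pi) Real.pi ×ˢ Set.Icc (-Real.pi) Real.pi := by
    ext p
    simp only [Set.mem_preimage, Set.mem_prod, Set.mem_Icc, Prod.fst_neg, Prod.snd_neg]
    constructor <;> rintro ⟨⟨_, _⟩, _, _⟩ <;>
      exact ⟨⟨by linarith, by linarith⟩, by linarith, by linarith⟩
  have := (Measure.measurePreserving_neg (volume : Measure (ℝ × ℝ))).restrict_preimage
    (measurableSet_Icc.prod measurableSet_Icc :
    MeasurableSet (Set.Icc (-Real.pi) Real.pi ×ˢ Set.Icc (-Real.pi) Real.pi))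
  rw [hs, ← h1] at this
  exact this

/-- Oddness is an equation between two continuous maps, composition with p ↦ -p and negation.
Closedness gives the completeness required by the spectral arguments. -/
theorem isClosed_oddL2 : IsClosed (oddL2 : Set (Lp ℂ 2 torus)) := by
  have h : (oddL2 : Set (Lp ℂ 2 torus)) =
      {f | Lp.compMeasurePreservingₗᵢ ℂ _ measurePreserving_neg_torus f = -f} := by
    ext f
    have h1 := Lp.coeFn_compMeasurePreserving f measurePreserving_neg_torus
    have h2 := Lp.coeFn_neg f
    change (∀ᵐ p ∂torus, f (-p) = -f p) ↔
      Lp.compMeasurePreserving _ measurePreserving_neg_torus f = -f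
    constructor
    · intro hf
      refine Lp.ext ?_
      filter_upwards [hf, h1, h2] with p e1 e2 e3
      rw [e2, e3, Pi.neg_apply, ← e1]
      rfl
    · intro hf
      rw [hf] at h1
      filter_upwards [h1, h2] with p e1 e2
      rw [e2, Pi.neg_apply] at e1
      exact e1.symm
  rw [h]
  exact isClosed_eq (LinearIsometry.continuous _) continuous_neg

instance : CompleteSpace oddL2 := isClosed_oddL2.completeSpace_coe

theorem inner_oddL2 (f g : oddL2) :
    ⟪f, g⟫_ℂ = ∫ p, ⟪(f : Lp ℂ 2 torus) p, (g : Lp ℂ 2 torus) p⟫_ℂ ∂torus := by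
  rw [Submodule.coe_inner, L2.inner_def]

theorem memLp_ofReal_of_bound {m : ℝ × ℝ → ℝ} (hm : Measurable m) {C : ℝ} (hb : ∀ p, |m p| ≤ C)
    (q : ENNReal) : MemLp (fun p => (m p : ℂ)) q torus :=
  MemLp.of_bound (Complex.measurable_ofReal.comp hm).aestronglyMeasurable C
    (Filter.Eventually.of_forall fun p => by
      rw [Complex.norm_real, Real.norm_eq_abs]; exact hb p)

/-- A bounded measurable odd real function, as an element of `L^{2,o}(𝕋²)`. -/
def boundedVec (φ : ℝ × ℝ → ℝ) (hm : Measurable φ) (C : ℝ) (hb : ∀ p, |φ p| ≤ C)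
    (ho : ∀ p, φ (-p) = -φ p) : oddL2 :=
  ⟨(memLp_ofReal_of_bound hm hb 2).toLp _, by
    have h := (memLp_ofReal_of_bound hm hb 2).coeFn_toLp
    change ∀ᵐ p ∂torus, _
    filter_upwards [h, quasiMeasurePreserving_neg.ae h] with p h1 h2
    rw [h1, h2, ho]
    simp⟩

theorem coeFn_boundedVec (φ : ℝ × ℝ → ℝ) (hm : Measurable φ) (C : ℝ) (hb : ∀ p, |φ p| ≤ C)
    (ho : ∀ p, φ (-p) = -φ p) :
    (boundedVec φ hm C hb ho : Lp ℂ 2 torus) =ᵐ[torus] fun p => (φ p : ℂ) :=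
  (memLp_ofReal_of_bound hm hb 2).coeFn_toLp

theorem coeFn_oddVec (φ : ℝ × ℝ → ℝ) (hc : Continuous φ) (hb : ∀ p, |φ p| ≤ 1)
    (ho : ∀ p, φ (-p) = -φ p) :
    (oddVec φ hc hb ho : Lp ℂ 2 torus) =ᵐ[torus] fun p => (φ p : ℂ) :=
  (memLp_of_continuous_of_le_one hc hb).coeFn_toLp

theorem inner_of_ae_eq_real {f g : oddL2} {φ χ : ℝ × ℝ → ℝ}
    (hf : (f : Lp ℂ 2 torus) =ᵐ[torus] fun p => (φ p : ℂ))
    (hg : (g : Lp ℂ 2 torus) =ᵐ[torus] fun p => (χ p : ℂ)) :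
    ⟪f, g⟫_ℂ = ((∫ p, φ p * χ p ∂torus : ℝ) : ℂ) := by
  rw [inner_oddL2, ← integral_complex_ofReal]
  refine integral_congr_ae ?_
  filter_upwards [hf, hg] with p h1 h2
  rw [h1, h2]
  simp [mul_comm]

section Multiplication

variable (m : ℝ × ℝ → ℝ) (hm : Measurable m) (C : ℝ) (hb : ∀ p, |m p| ≤ C)
  (he : ∀ p, m (-p) = m p)

theorem coeFn_holderMul (f : Lp ℂ 2 torus) :
    (ContinuousLinearMap.mul ℂ ℂ).holderL torus ⊤ 2 2
      ((memLp_ofReal_of_bound hm hb ⊤).toLp _) f =ᵐ[torus] fun p => (m p : ℂ) * f p := by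
  have h := (ContinuousLinearMap.mul ℂ ℂ).coeFn_holder (r := 2)
    ((memLp_ofReal_of_bound hm hb ⊤).toLp _) f
  filter_upwards [h, (memLp_ofReal_of_bound hm hb ⊤).coeFn_toLp] with p h1 h2
  rw [ContinuousLinearMap.holderL_apply_apply, h1, h2]
  rfl

/-- Multiplication of odd functions by a bounded even real function. -/
def mulOp : oddL2 →L[ℂ] oddL2 :=
  (((ContinuousLinearMap.mul ℂ ℂ).holderL torus ⊤ 2 2
    ((memLp_ofReal_of_bound hm hb ⊤).toLp _)).comp oddL2.subtypeL).codRestrict oddL2 fun f => by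
      have h := coeFn_holderMul m hm C hb f
      have hf' : ∀ᵐ p ∂torus, (f : Lp ℂ 2 torus) (-p) = -(f : Lp ℂ 2 torus) p := f.2
      change ∀ᵐ p ∂torus, _
      filter_upwards [hf', h, quasiMeasurePreserving_neg.ae h] with p h1 h2 h3
      refine h3.trans ?_
      rw [h1, he, mul_neg]
      exact congrArg Neg.neg h2.symm

theorem coeFn_mulOp (f : oddL2) : (mulOp m hm C hb he f : Lp ℂ 2 torus) =ᵐ[torus]
    fun p => (m p : ℂ) * (f : Lp ℂ 2 torus) p :=
  coeFn_holderMul m hm C hb f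

theorem isSelfAdjoint_mulOp : IsSelfAdjoint (mulOp m hm C hb he) := by
  rw [ContinuousLinearMap.isSelfAdjoint_iff_isSymmetric]
  intro f g
  change ⟪mulOp m hm C hb he f, g⟫_ℂ = ⟪f, mulOp m hm C hb he g⟫_ℂ
  rw [inner_oddL2, inner_oddL2]
  refine integral_congr_ae ?_
  filter_upwards [coeFn_mulOp m hm C hb he f, coeFn_mulOp m hm C hb he g] with p h1 h2
  rw [h1, h2]
  simp
  ring

theorem mulOp_injective (h0 : ∀ᵐ p ∂torus, m p ≠ 0) (f : oddL2)
    (hf : mulOp m hm C hb he f = 0) : f = 0 := by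
  refine oddL2_ext ?_
  have h1 := coeFn_mulOp m hm C hb he f
  rw [hf] at h1
  have h2 := Lp.coeFn_zero ℂ 2 torus
  filter_upwards [h0, h1, h2] with p e0 e1 e2
  rw [ZeroMemClass.coe_zero, e2] at e1 ⊢
  have e3 : (m p : ℂ) ≠ 0 := by exact_mod_cast e0
  exact (mul_eq_zero.1 e1.symm).resolve_left e3

end Multiplication

/-- For fixed p₁ only countably many p₂ qualify, so Fubini gives measure zero. This yields both the
injectivity of √A and the absence of eigenvalues of A. -/
theorem torus_cos_add_cos_eq (t : ℝ) :
    ∀ᵐ p ∂torus, Real.cos p.1 + Real.cos p.2 ≠ t := by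
  have hcount : ∀ u : ℝ, {y : ℝ | Real.cos y = u}.Countable := by
    intro u
    by_cases h : ∃ y₀, Real.cos y₀ = u
    · obtain ⟨y₀, rfl⟩ := h
      have hsub : {y : ℝ | Real.cos y = Real.cos y₀} ⊆
          Set.range (fun k : ℤ => 2 * (k : ℝ) * Real.pi + y₀) ∪
            Set.range (fun k : ℤ => 2 * (k : ℝ) * Real.pi - y₀) := by
        intro y hy
        obtain ⟨k, hk | hk⟩ := (Real.cos_eq_cos_iff.1 (Eq.symm hy))
        · exact Or.inl ⟨k, hk.symm⟩
        · exact Or.inr ⟨k, hk.symm⟩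
      exact ((Set.countable_range _).union (Set.countable_range _)).mono hsub
    · convert Set.countable_empty
      exact Set.eq_empty_of_forall_notMem fun y hy => h ⟨y, hy⟩
  have hmeas : MeasurableSet {p : ℝ × ℝ | Real.cos p.1 + Real.cos p.2 = t} :=
    measurableSet_eq_fun (by fun_prop) measurable_const
  rw [ae_iff]
  simp only [not_not]
  rw [torus_eq_prod, Measure.measure_prod_null hmeas]
  refine Filter.Eventually.of_forall fun x => ?_
  refine Set.Countable.measure_zero ((hcount (t - Real.cos x)).mono ?_) _
  intro y hy
  exact eq_sub_of_add_eq' hy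

theorem weight_ne_ae {σ : ℝ} (hσ : σ = 1 ∨ σ = -1) (t : ℝ) : ∀ᵐ p ∂torus, weight σ p ≠ t := by
  filter_upwards [torus_cos_add_cos_eq ((4 - t) * σ / 2)] with p hp h
  apply hp
  rw [← h, weight]
  rcases hσ with rfl | rfl <;> ring

theorem weight_neg (σ : ℝ) (p : ℝ × ℝ) : weight σ (-p) = weight σ p := by
  simp [weight]

theorem weight_le {σ : ℝ} (hσ : σ = 1 ∨ σ = -1) (p : ℝ × ℝ) : weight σ p ≤ 8 := by
  have h1 := Real.cos_le_one p.1
  have h2 := Real.cos_le_one p.2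
  have h3 := Real.neg_one_le_cos p.1
  have h4 := Real.neg_one_le_cos p.2
  rw [weight]
  rcases hσ with rfl | rfl <;> linarith

theorem abs_sqrt_weight_le {σ : ℝ} (hσ : σ = 1 ∨ σ = -1) (p : ℝ × ℝ) :
    |√(weight σ p)| ≤ √8 := by
  rw [abs_of_nonneg (Real.sqrt_nonneg _)]
  exact Real.sqrt_le_sqrt (weight_le hσ p)

/-- Multiplication by the square root of the weight. -/
def sqrtOp {σ : ℝ} (hσ : σ = 1 ∨ σ = -1) : oddL2 →L[ℂ] oddL2 :=
  mulOp (fun p => √(weight σ p)) (continuous_weight σ).sqrt.measurable (√8)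
    (abs_sqrt_weight_le hσ) (fun p => by rw [weight_neg])

theorem isSelfAdjoint_sqrtOp {σ : ℝ} (hσ : σ = 1 ∨ σ = -1) : IsSelfAdjoint (sqrtOp hσ) :=
  isSelfAdjoint_mulOp _ _ _ _ _

theorem sqrtOp_injective {σ : ℝ} (hσ : σ = 1 ∨ σ = -1) (f : oddL2) (hf : sqrtOp hσ f = 0) :
    f = 0 := by
  refine mulOp_injective _ _ _ _ _ ?_ f hf
  filter_upwards [weight_ne_ae hσ 0] with p hp
  exact (Real.sqrt_pos.2 (lt_of_le_of_ne (weight_nonneg hσ p) hp.symm)).ne'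

theorem coeFn_sqrtOp_sq {σ : ℝ} (hσ : σ = 1 ∨ σ = -1) (f : oddL2) :
    ((sqrtOp hσ * sqrtOp hσ) f : Lp ℂ 2 torus) =ᵐ[torus]
      fun p => (weight σ p : ℂ) * (f : Lp ℂ 2 torus) p := by
  rw [mul_apply_eq_comp]
  filter_upwards [coeFn_mulOp (fun p => √(weight σ p)) (continuous_weight σ).sqrt.measurable (√8)
    (abs_sqrt_weight_le hσ) (fun p => by rw [weight_neg]) f,
    coeFn_mulOp (fun p => √(weight σ p)) (continuous_weight σ).sqrt.measurable (√8)
    (abs_sqrt_weight_le hσ) (fun p => by rw [weight_neg]) (sqrtOp hσ f)] with p h1 h2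
  refine h2.trans ?_
  rw [sqrtOp, h1, ← mul_assoc, ← Complex.ofReal_mul, Real.mul_self_sqrt (weight_nonneg hσ p)]

theorem energy_zero (p : ℝ × ℝ) : energy (0, 0) p = weight 1 p := by
  simp [energy, weight]
  ring

theorem coeFn_freeHamiltonian (f : oddL2) :
    (freeHamiltonian (0, 0) f : Lp ℂ 2 torus) =ᵐ[torus]
      fun p => (weight 1 p : ℂ) * (f : Lp ℂ 2 torus) p := by
  have h := coeFn_mulEnergy (0, 0) f
  simp only [energy_zero] at h
  exact h

theorem freeHamiltonian_eq : freeHamiltonian (0, 0) =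
    sqrtOp (σ := 1) (Or.inl rfl) * sqrtOp (σ := 1) (Or.inl rfl) := by
  ext1 f
  refine oddL2_ext ((coeFn_freeHamiltonian f).trans (coeFn_sqrtOp_sq _ f).symm)

theorem eight_sub_freeHamiltonian_eq : (8 : ℂ) • 1 - freeHamiltonian (0, 0) =
    sqrtOp (σ := -1) (Or.inr rfl) * sqrtOp (σ := -1) (Or.inr rfl) := by
  ext1 f
  refine oddL2_ext ?_
  have h1 := coeFn_sqrtOp_sq (σ := -1) (Or.inr rfl) f
  have h2 := coeFn_freeHamiltonian f
  have h3 := Lp.coeFn_sub ((8 : ℂ) • (f : Lp ℂ 2 torus)) (freeHamiltonian (0, 0) f)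
  have h4 := Lp.coeFn_smul (8 : ℂ) (f : Lp ℂ 2 torus)
  filter_upwards [h1, h2, h3, h4] with p e1 e2 e3 e4
  rw [e1]
  refine e3.trans ?_
  rw [Pi.sub_apply, e4, e2, Pi.smul_apply, smul_eq_mul, ← sub_mul]
  congr 1
  simp only [weight]
  push_cast
  ring

theorem isSelfAdjoint_freeHamiltonian : IsSelfAdjoint (freeHamiltonian (0, 0)) := by
  rw [freeHamiltonian_eq]
  exact isSelfAdjoint_mul_self (isSelfAdjoint_sqrtOp _)

end Operators

/-! ### The factorisation H = √A B √A and the determinant -/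

section BirmanSchwinger

open scoped InnerProductSpace

/-- The functions `sin p₁`, `sin 2p₁`, `sin p₁ cos p₂`. -/
def trig (k : Fin 3) (p : ℝ × ℝ) : ℝ :=
  Real.sin p.1 * ![1, 2 * Real.cos p.1, Real.cos p.2] k

/-- The functions `trig`, and the same with the variables exchanged. -/
def trigSwap (s : Fin 2) (k : Fin 3) (p : ℝ × ℝ) : ℝ := ![trig k p, trig k p.swap] s

theorem continuous_trig (k : Fin 3) : Continuous (trig k) := by
  unfold trig
  fin_cases k <;> simp <;> fun_prop

theorem continuous_trigSwap (s : Fin 2) (k : Fin 3) : Continuous (trigSwap s k) := by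
  fin_cases s
  · exact continuous_trig k
  · exact (continuous_trig k).comp continuous_swap

theorem trig_neg (k : Fin 3) (p : ℝ × ℝ) : trig k (-p) = -trig k p := by
  fin_cases k <;> simp [trig]

theorem trigSwap_neg (s : Fin 2) (k : Fin 3) (p : ℝ × ℝ) :
    trigSwap s k (-p) = -trigSwap s k p := by
  fin_cases s
  · exact trig_neg k p
  · exact trig_neg k p.swap

/-- The constant 2 comes from sin 2p₁ = 2 sin p₁ cos p₁. The bound makes the quotients by the square
root of the weight bounded, hence square integrable. -/
theorem abs_trig_le {σ : ℝ} (hσ : σ = 1 ∨ σ = -1) (k : Fin 3) (p : ℝ × ℝ) :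
    |trig k p| ≤ 2 * √(weight σ p) := by
  have h1 : |Real.sin p.1| ≤ √(weight σ p) := by
    rw [← Real.sqrt_sq_eq_abs]
    exact Real.sqrt_le_sqrt (sin_sq_fst_le_weight hσ p)
  have h2 : |![1, 2 * Real.cos p.1, Real.cos p.2] k| ≤ 2 := by
    have c1 := Real.abs_cos_le_one p.1
    have c2 := Real.abs_cos_le_one p.2
    fin_cases k <;> simp [abs_mul] <;> linarith
  rw [trig, abs_mul, mul_comm]
  exact mul_le_mul h2 h1 (abs_nonneg _) (by norm_num)

theorem abs_trigSwap_le {σ : ℝ} (hσ : σ = 1 ∨ σ = -1) (s : Fin 2) (k : Fin 3) (p : ℝ × ℝ) :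
    |trigSwap s k p| ≤ 2 * √(weight σ p) := by
  fin_cases s
  · exact abs_trig_le hσ k p
  · exact (abs_trig_le hσ k p.swap).trans_eq (by rw [weight_swap])

/-- The functions `trigSwap` divided by the square root of the weight. -/
def resolvedVec {σ : ℝ} (hσ : σ = 1 ∨ σ = -1) (s : Fin 2) (k : Fin 3) : oddL2 :=
  boundedVec (fun p => trigSwap s k p / √(weight σ p))
    ((continuous_trigSwap s k).measurable.div (continuous_weight σ).sqrt.measurable) 2
    (fun p => by
      rw [abs_div, abs_of_nonneg (Real.sqrt_nonneg _)]
      exact div_le_of_le_mul₀ (Real.sqrt_nonneg _) (by norm_num) (abs_trigSwap_le hσ s k p))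
    (fun p => by rw [weight_neg, trigSwap_neg, neg_div])

theorem coeFn_resolvedVec {σ : ℝ} (hσ : σ = 1 ∨ σ = -1) (s : Fin 2) (k : Fin 3) :
    (resolvedVec hσ s k : Lp ℂ 2 torus) =ᵐ[torus]
      fun p => ((trigSwap s k p / √(weight σ p) : ℝ) : ℂ) :=
  coeFn_boundedVec _ _ _ _ _

theorem coeFn_sqrtOp_resolvedVec {σ : ℝ} (hσ : σ = 1 ∨ σ = -1) (s : Fin 2) (k : Fin 3) :
    (sqrtOp hσ (resolvedVec hσ s k) : Lp ℂ 2 torus) =ᵐ[torus]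
      fun p => ((trigSwap s k p : ℝ) : ℂ) := by
  filter_upwards [coeFn_resolvedVec hσ s k,
    coeFn_mulOp (fun p => √(weight σ p)) (continuous_weight σ).sqrt.measurable (√8)
    (abs_sqrt_weight_le hσ) (fun p => by rw [weight_neg]) (resolvedVec hσ s k)] with p h1 h2
  refine h2.trans ?_
  rw [h1, ← Complex.ofReal_mul]
  congr 1
  -- Where the weight vanishes the quotient is 0 by convention. The product is still correct there,
  -- because the bound forces `trigSwap` to vanish too.
  rcases eq_or_ne √(weight σ p) 0 with h | h
  · have h3 := abs_trigSwap_le hσ s k p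
    rw [h, mul_zero] at h3
    rw [abs_nonpos_iff.1 h3, zero_div, mul_zero]
  · exact mul_div_cancel₀ _ h

theorem sqrtOp_resolvedVec_eq_oddVec {σ : ℝ} (hσ : σ = 1 ∨ σ = -1) (s : Fin 2) (k : Fin 3)
    {φ : ℝ × ℝ → ℝ} (hc : Continuous φ) (hb : ∀ p, |φ p| ≤ 1) (ho : ∀ p, φ (-p) = -φ p)
    (h : ∀ p, trigSwap s k p = φ p) : sqrtOp hσ (resolvedVec hσ s k) = oddVec φ hc hb ho := by
  refine oddL2_ext ((coeFn_sqrtOp_resolvedVec hσ s k).trans ?_)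
  simp only [h]
  exact (coeFn_oddVec φ hc hb ho).symm

/-- The coupling constants of the three pairs of rank one terms. -/
def coupling (x : ℝ × ℝ) : Fin 3 → ℝ :=
  ![x.1 / (2 * Real.pi) ^ 2, x.2 / (2 * Real.pi) ^ 2, x.2 / Real.pi ^ 2]

theorem continuous_coupling : Continuous coupling := by
  refine continuous_pi fun k => ?_
  unfold coupling
  fin_cases k <;> simp <;> fun_prop

theorem coupling_neg (x : ℝ × ℝ) : coupling (-x) = -coupling x := by
  ext k
  fin_cases k <;> simp [coupling, neg_div]

/-- The operator `B` such that `A + V = √A B √A`. -/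
def birman {σ : ℝ} (hσ : σ = 1 ∨ σ = -1) (x : ℝ × ℝ) : oddL2 →L[ℂ] oddL2 :=
  1 + pairSum (resolvedVec hσ) (coupling x)

theorem isSelfAdjoint_birman {σ : ℝ} (hσ : σ = 1 ∨ σ = -1) (x : ℝ × ℝ) :
    IsSelfAdjoint (birman hσ x) :=
  isSelfAdjoint_one_add_pairSum _ _

theorem hasFiniteRange_birman_sub_one {σ : ℝ} (hσ : σ = 1 ∨ σ = -1) (x : ℝ × ℝ) :
    ((birman hσ x - 1 : oddL2 →L[ℂ] oddL2) : oddL2 →ₗ[ℂ] oddL2).HasFiniteRange := by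
  rw [birman, add_sub_cancel_left]
  exact hasFiniteRange_pairSum _ _

/-- The six functions in the interaction. -/
def interactionVec : Fin 2 → Fin 3 → oddL2 :=
  ![![sinFst, sinTwoFst, sinFstCosSnd], ![sinSnd, sinTwoSnd, sinSndCosFst]]

theorem interaction_eq_pairSum (x : ℝ × ℝ) :
    interaction x.1 x.2 = pairSum interactionVec (coupling x) := by
  rw [pairSum, Fin.sum_univ_three]
  rfl

theorem sqrtOp_resolvedVec {σ : ℝ} (hσ : σ = 1 ∨ σ = -1) (s : Fin 2) (k : Fin 3) :
    sqrtOp hσ (resolvedVec hσ s k) = interactionVec s k := by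
  fin_cases s <;> fin_cases k
  · change sqrtOp hσ (resolvedVec hσ 0 0) = sinFst
    exact sqrtOp_resolvedVec_eq_oddVec hσ 0 0 _ _ _ fun p => by simp [trigSwap, trig]
  · change sqrtOp hσ (resolvedVec hσ 0 1) = sinTwoFst
    exact sqrtOp_resolvedVec_eq_oddVec hσ 0 1 _ _ _ fun p => by
      simp [trigSwap, trig, Real.sin_two_mul]; ring
  · change sqrtOp hσ (resolvedVec hσ 0 2) = sinFstCosSnd
    exact sqrtOp_resolvedVec_eq_oddVec hσ 0 2 _ _ _ fun p => by simp [trigSwap, trig]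
  · change sqrtOp hσ (resolvedVec hσ 1 0) = sinSnd
    exact sqrtOp_resolvedVec_eq_oddVec hσ 1 0 _ _ _ fun p => by simp [trigSwap, trig]
  · change sqrtOp hσ (resolvedVec hσ 1 1) = sinTwoSnd
    exact sqrtOp_resolvedVec_eq_oddVec hσ 1 1 _ _ _ fun p => by
      simp [trigSwap, trig, Real.sin_two_mul]; ring
  · change sqrtOp hσ (resolvedVec hσ 1 2) = sinSndCosFst
    exact sqrtOp_resolvedVec_eq_oddVec hσ 1 2 _ _ _ fun p => by simp [trigSwap, trig]

theorem sqrtOp_birman_sqrtOp {σ : ℝ} (hσ : σ = 1 ∨ σ = -1) (x : ℝ × ℝ) :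
    sqrtOp hσ * birman hσ x * sqrtOp hσ = sqrtOp hσ * sqrtOp hσ + interaction x.1 x.2 := by
  rw [birman, mul_add, add_mul, mul_one, conj_pairSum (isSelfAdjoint_sqrtOp hσ),
    interaction_eq_pairSum]
  simp only [sqrtOp_resolvedVec]

theorem hamiltonian_eq (x : ℝ × ℝ) : hamiltonian x.1 x.2 (0, 0) =
    sqrtOp (σ := 1) (Or.inl rfl) * birman (σ := 1) (Or.inl rfl) x * sqrtOp (Or.inl rfl) := by
  rw [sqrtOp_birman_sqrtOp, ← freeHamiltonian_eq]
  rfl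

/-- Turns eigenvalues above 8 into negative ones: 8 - A is multiplication by `weight (-1)`, and -V
is the interaction with both parameters negated. -/
theorem eight_sub_hamiltonian_eq (x : ℝ × ℝ) : (8 : ℂ) • 1 - hamiltonian x.1 x.2 (0, 0) =
    sqrtOp (σ := -1) (Or.inr rfl) * birman (σ := -1) (Or.inr rfl) (-x) *
      sqrtOp (Or.inr rfl) := by
  rw [sqrtOp_birman_sqrtOp, ← eight_sub_freeHamiltonian_eq, interaction_eq_pairSum, coupling_neg,
    pairSum_neg, ← interaction_eq_pairSum, hamiltonian]
  abel

/-- The Gram matrix of the functions `trig` divided by the square root of the weight. -/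
def gram (σ : ℝ) : Matrix (Fin 3) (Fin 3) ℝ :=
  fun j k => ∫ p, trig j p * trig k p / weight σ p ∂torus

theorem div_sqrt_mul_div_sqrt {σ : ℝ} (hσ : σ = 1 ∨ σ = -1) (a b : ℝ) (p : ℝ × ℝ) :
    a / √(weight σ p) * (b / √(weight σ p)) = a * b / weight σ p := by
  rw [div_mul_div_comm, Real.mul_self_sqrt (weight_nonneg hσ p)]

theorem inner_resolvedVec_same {σ : ℝ} (hσ : σ = 1 ∨ σ = -1) (s : Fin 2) (j k : Fin 3) :
    ⟪resolvedVec hσ s j, resolvedVec hσ s k⟫_ℂ = (gram σ j k : ℂ) := by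
  rw [inner_of_ae_eq_real (coeFn_resolvedVec hσ s j) (coeFn_resolvedVec hσ s k)]
  simp only [div_sqrt_mul_div_sqrt hσ]
  congr 1
  fin_cases s
  · rfl
  · rw [gram, ← integral_torus_swap]
    simp only [weight_swap]
    rfl

/-- The first factor is odd in p₁, while the exchanged factor and the weight are even in it. Hence
the two families of three vectors are orthogonal. -/
theorem integral_trig_mul_trig_swap {σ : ℝ} (hσ : σ = 1 ∨ σ = -1) (j k : Fin 3) :
    ∫ p, trig j p * trig k p.swap / weight σ p ∂torus = 0 := by
  refine integral_torus_eq_zero ?_ fun x y => ?_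
  · refine Integrable.of_bound (C := 4) ?_ (Filter.Eventually.of_forall fun p => ?_)
    · exact Measurable.aestronglyMeasurable (Measurable.div
        (((continuous_trig j).mul ((continuous_trig k).comp continuous_swap)).measurable)
        (continuous_weight σ).measurable)
    · have hw := weight_nonneg hσ p
      rw [Real.norm_eq_abs, abs_div, abs_of_nonneg hw, abs_mul]
      refine div_le_of_le_mul₀ hw (by norm_num) ?_
      have h1 := abs_trig_le hσ j p
      have h2 := abs_trig_le hσ k p.swap
      rw [weight_swap] at h2
      calc |trig j p| * |trig k p.swap| ≤ (2 * √(weight σ p)) * (2 * √(weight σ p)) :=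
            mul_le_mul h1 h2 (abs_nonneg _) (by positivity)
        _ = 4 * (√(weight σ p) * √(weight σ p)) := by ring
        _ = 4 * weight σ p := by rw [Real.mul_self_sqrt hw]
  · have h1 : trig j (-x, y) = -trig j (x, y) := by fin_cases j <;> simp [trig]
    have h2 : trig k (-x, y).swap = trig k (x, y).swap := by fin_cases k <;> simp [trig]
    have h3 : weight σ (-x, y) = weight σ (x, y) := by simp [weight]
    rw [h1, h2, h3, neg_mul, neg_div]

theorem inner_resolvedVec_zero_one {σ : ℝ} (hσ : σ = 1 ∨ σ = -1) (j k : Fin 3) :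
    ⟪resolvedVec hσ 0 j, resolvedVec hσ 1 k⟫_ℂ = 0 := by
  rw [inner_of_ae_eq_real (coeFn_resolvedVec hσ 0 j) (coeFn_resolvedVec hσ 1 k)]
  simp only [div_sqrt_mul_div_sqrt hσ]
  exact_mod_cast integral_trig_mul_trig_swap hσ j k

/-- The finite matrix whose determinant is `C⁻`. -/
def birmanMatrix (σ : ℝ) (x : ℝ × ℝ) : Matrix (Fin 3) (Fin 3) ℝ :=
  1 + gram σ * Matrix.diagonal (coupling x)

theorem birman_injective {σ : ℝ} (hσ : σ = 1 ∨ σ = -1) {x : ℝ × ℝ}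
    (hdet : (birmanMatrix σ x).det ≠ 0) (f : oddL2) (hf : birman hσ x f = 0) : f = 0 :=
  one_add_pairSum_injective (inner_resolvedVec_same hσ) (inner_resolvedVec_zero_one hσ) hdet f hf

/-- A moment acquires the sign σ^(m + n), so σ survives only in the entries linking the first
function with the other two. The matrices for σ = ±1 are conjugate by diag(σ, 1, 1). -/
theorem gram_eq {σ : ℝ} (hσ : σ = 1 ∨ σ = -1) : gram σ =
    !![moment 1 0 0, σ * (2 * moment 1 1 0), σ * moment 1 0 1;
      σ * (2 * moment 1 1 0), 4 * moment 1 2 0, 2 * moment 1 1 1;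
      σ * moment 1 0 1, 2 * moment 1 1 1, moment 1 0 2] := by
  have hm : ∀ m n, moment σ m n = σ ^ (m + n) * moment 1 m n := fun m n => by
    rcases hσ with rfl | rfl
    · simp
    · exact moment_neg_one m n
  have key : ∀ (j k : Fin 3) (c : ℝ) (m n : ℕ),
      (∀ p, trig j p * trig k p =
        c * (Real.sin p.1 ^ 2 * Real.cos p.1 ^ m * Real.cos p.2 ^ n)) →
      gram σ j k = c * (σ ^ (m + n) * moment 1 m n) := fun j k c m n h => by
    rw [← hm, moment, ← integral_const_mul, gram]
    simp only [h, mul_div_assoc]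
  have hs : σ ^ 2 = 1 := by rcases hσ with rfl | rfl <;> norm_num
  ext j k
  fin_cases j <;> fin_cases k
  · refine (key 0 0 1 0 0 fun p => ?_).trans ?_ <;> simp [trig]; ring
  · refine (key 0 1 2 1 0 fun p => ?_).trans ?_ <;> simp [trig] <;> ring
  · refine (key 0 2 1 0 1 fun p => ?_).trans ?_ <;> simp [trig]; ring
  · refine (key 1 0 2 1 0 fun p => ?_).trans ?_ <;> simp [trig] <;> ring
  · refine (key 1 1 4 2 0 fun p => ?_).trans ?_ <;> simp [trig, hs]; ring
  · refine (key 1 2 2 1 1 fun p => ?_).trans ?_ <;> simp [trig, hs]; ring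
  · refine (key 2 0 1 0 1 fun p => ?_).trans ?_ <;> simp [trig]; ring
  · refine (key 2 1 2 1 1 fun p => ?_).trans ?_ <;> simp [trig, hs]; ring
  · refine (key 2 2 1 0 2 fun p => ?_).trans ?_ <;> simp [trig, hs]; ring

/-- Vieta's formulas eliminate the square roots: μ₀± are the roots of the quadratic on the right.
Likewise for μ₁± below. -/
theorem mu0_product (mu : ℝ) : (30 * Real.pi - 3 * Real.pi ^ 2 - 64) * ((mu - mu0p) * (mu - mu0m)) =
    (30 * Real.pi - 3 * Real.pi ^ 2 - 64) * mu ^ 2 - (22 - 15 / 2 * Real.pi) * Real.pi * mu +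
      3 / 4 * Real.pi ^ 2 := by
  have ha := curve_const_pos.ne'
  have hdisc : 0 ≤ 1044 * Real.pi ^ 2 - 6720 * Real.pi + 10816 := by
    obtain ⟨h1, h2, h3, h4, -⟩ := pi_bounds
    linarith
  have hs := Real.sq_sqrt hdisc
  rw [mu0p, mu0m, show 240 * Real.pi - 24 * Real.pi ^ 2 - 512 =
    8 * (30 * Real.pi - 3 * Real.pi ^ 2 - 64) by ring]
  set s := √(1044 * Real.pi ^ 2 - 6720 * Real.pi + 10816)
  set a := 30 * Real.pi - 3 * Real.pi ^ 2 - 64 with hadef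
  have h1 : a * ((mu - (88 - 30 * Real.pi + s) / (8 * a) * Real.pi) *
      (mu - (88 - 30 * Real.pi - s) / (8 * a) * Real.pi)) =
      a * mu ^ 2 - (22 - 15 / 2 * Real.pi) * Real.pi * mu +
        ((88 - 30 * Real.pi) ^ 2 - s ^ 2) * Real.pi ^ 2 / (64 * a) := by
    field_simp
    ring
  rw [h1, hs]
  congr 1
  rw [div_eq_iff (by positivity), hadef]
  ring

theorem mu1_product (mu : ℝ) : (30 * Real.pi - 3 * Real.pi ^ 2 - 64) * ((mu - mu1p) * (mu - mu1m)) =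
    (30 * Real.pi - 3 * Real.pi ^ 2 - 64) * mu ^ 2 -
      (64 - 8 * Real.pi - 9 / 2 * Real.pi ^ 2) * mu + (3 * Real.pi ^ 2 - 6 * Real.pi) := by
  have ha := curve_const_pos.ne'
  have hdisc : 0 ≤ 225 * Real.pi ^ 4 - 1440 * Real.pi ^ 3 + 3904 * Real.pi ^ 2 - 10240 * Real.pi
      + 16384 := by
    obtain ⟨h1, h2, h3, h4, h5, h6, h7, h8⟩ := pi_bounds
    linarith
  have hs := Real.sq_sqrt hdisc
  rw [mu1p, mu1m, show 120 * Real.pi - 12 * Real.pi ^ 2 - 256 =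
    4 * (30 * Real.pi - 3 * Real.pi ^ 2 - 64) by ring]
  set s := √(225 * Real.pi ^ 4 - 1440 * Real.pi ^ 3 + 3904 * Real.pi ^ 2 - 10240 * Real.pi + 16384)
  set a := 30 * Real.pi - 3 * Real.pi ^ 2 - 64 with hadef
  have h1 : a * ((mu - (128 - 16 * Real.pi - 9 * Real.pi ^ 2 + s) / (4 * a)) *
      (mu - (128 - 16 * Real.pi - 9 * Real.pi ^ 2 - s) / (4 * a))) =
      a * mu ^ 2 - (64 - 8 * Real.pi - 9 / 2 * Real.pi ^ 2) * mu +
        ((128 - 16 * Real.pi - 9 * Real.pi ^ 2) ^ 2 - s ^ 2) / (16 * a) := by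
    field_simp
    ring
  rw [h1, hs]
  congr 1
  rw [div_eq_iff (by positivity), hadef]
  ring

/-- After the moments are inserted, both sides are the same polynomial in λ, μ and π up to the
common denominator. Only σ² enters, so the value does not depend on the sign. -/
theorem det_birmanMatrix {σ : ℝ} (hσ : σ = 1 ∨ σ = -1) (x : ℝ × ℝ) :
    (birmanMatrix σ x).det = cMinus x.1 x.2 := by
  have hs : σ ^ 2 = 1 := by rcases hσ with rfl | rfl <;> norm_num
  have hpi := Real.pi_ne_zero
  have hc : cMinus x.1 x.2 =
      (8 * ((30 * Real.pi - 3 * Real.pi ^ 2 - 64) * ((x.2 - mu0p) * (x.2 - mu0m))) +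
        x.1 * ((30 * Real.pi - 3 * Real.pi ^ 2 - 64) * ((x.2 - mu1p) * (x.2 - mu1m)))) /
        (6 * Real.pi ^ 2) := by
    rw [cMinus]
    ring
  have hmat : birmanMatrix σ x = 1 + gram σ * Matrix.diagonal (coupling x) := rfl
  rw [hc, mu0_product, mu1_product, hmat, gram_eq hσ, Matrix.det_fin_three]
  simp only [Matrix.add_apply, Matrix.mul_diagonal, coupling, Matrix.one_apply]
  simp only [moment_zero_zero, moment_one_zero, moment_two_zero, moment_zero_one, moment_one_one,
    moment_zero_two]
  simp
  field_simp
  rw [← sub_eq_zero]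
  ring_nf
  simp only [hs]
  ring

end BirmanSchwinger

/-! ### Essential spectrum and constancy of the eigenvalue numbers -/

section Main

open scoped InnerProductSpace

theorem hasFiniteRange_interaction (lam mu : ℝ) :
    (interaction lam mu : oddL2 →ₗ[ℂ] oddL2).HasFiniteRange := by
  rw [interaction_eq_pairSum (lam, mu)]
  exact hasFiniteRange_pairSum _ _

theorem isUnit_freeHamiltonian_sub {z : ℂ} (hz : z ∉ ((↑) : ℝ → ℂ) '' Set.Icc 0 8) :
    IsUnit (freeHamiltonian (0, 0) - z • ContinuousLinearMap.id ℂ oddL2) := by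
  refine isUnit_sub_smul_of_notMem (b := 8) isSelfAdjoint_freeHamiltonian (fun f => ?_)
    (fun f => ?_) hz
  · rw [freeHamiltonian_eq]
    exact re_inner_mul_self_nonneg (isSelfAdjoint_sqrtOp _) f
  · have h := re_inner_mul_self_nonneg (isSelfAdjoint_sqrtOp (σ := -1) (Or.inr rfl)) f
    rw [← eight_sub_freeHamiltonian_eq] at h
    rw [Complex.ofReal_ofNat]
    exact h

theorem freeHamiltonian_sub_injective (t : ℝ) (f : oddL2)
    (hf : (freeHamiltonian (0, 0) - (t : ℂ) • (1 : oddL2 →L[ℂ] oddL2)) f = 0) : f = 0 := by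
  refine oddL2_ext ?_
  have h0 : freeHamiltonian (0, 0) f = (t : ℂ) • f := sub_eq_zero.1 hf
  have h1 := coeFn_freeHamiltonian f
  rw [h0] at h1
  filter_upwards [h1, Lp.coeFn_smul (t : ℂ) (f : Lp ℂ 2 torus), Lp.coeFn_zero ℂ 2 torus,
    weight_ne_ae (σ := 1) (Or.inl rfl) t] with p e1 e2 e3 e4
  rw [ZeroMemClass.coe_zero, e3]
  have e5 : (t : ℂ) * (f : Lp ℂ 2 torus) p = (weight 1 p : ℂ) * (f : Lp ℂ 2 torus) p :=
    e2.symm.trans e1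
  rw [← sub_eq_zero, ← sub_mul] at e5
  refine (mul_eq_zero.1 e5).resolve_left (sub_ne_zero.2 ?_)
  exact_mod_cast e4.symm

/-- Odd functions concentrated near the level set `ℰ₀ = t`. -/
theorem exists_approximate_eigenvector {t : ℝ} (ht : t ∈ Set.Icc (0 : ℝ) 8) {ε : ℝ} (hε : 0 < ε) :
    ∃ f : oddL2, f ≠ 0 ∧
      ‖(freeHamiltonian (0, 0) - (t : ℂ) • (1 : oddL2 →L[ℂ] oddL2)) f‖ ≤ ε * ‖f‖ := by
  -- The tent localises to |ℰ₀ - t| < ε, and the factor sin p₁ makes the even cutoff odd.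
  set φ : ℝ × ℝ → ℝ := fun p => Real.sin p.1 * max 0 (1 - |weight 1 p - t| / ε) with hφ
  have hw := continuous_weight 1
  have hc : Continuous φ := by fun_prop
  have hb : ∀ p, |φ p| ≤ 1 := fun p => by
    rw [hφ, abs_mul]
    refine mul_le_one₀ (Real.abs_sin_le_one _) (abs_nonneg _) ?_
    rw [abs_of_nonneg (le_max_left _ _)]
    exact max_le zero_le_one (sub_le_self _ (by positivity))
  have ho : ∀ p, φ (-p) = -φ p := fun p => by
    simp [hφ, weight_neg]
  have hcoe := coeFn_oddVec φ hc hb ho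
  refine ⟨oddVec φ hc hb ho, fun h0 => ?_, ?_⟩
  · rw [h0] at hcoe
    have hae : φ =ᵐ[torus] fun _ => 0 := by
      filter_upwards [hcoe, Lp.coeFn_zero ℂ 2 torus] with p e1 e2
      rw [ZeroMemClass.coe_zero, e2] at e1
      exact Complex.ofReal_eq_zero.1 e1.symm
    set U : Set (ℝ × ℝ) := Set.Ioo 0 Real.pi ×ˢ Set.Ioo 0 Real.pi with hU
    have hUo : IsOpen U := isOpen_Ioo.prod isOpen_Ioo
    have hpi := Real.pi_pos
    have hUsub : U ⊆ Set.Ico (-Real.pi) Real.pi ×ˢ Set.Ico (-Real.pi) Real.pi :=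
      Set.prod_mono (fun x hx => ⟨by linarith [hx.1], hx.2⟩) fun x hx => ⟨by linarith [hx.1], hx.2⟩
    have hzero : Set.EqOn φ (fun _ => 0) U :=
      Measure.eqOn_open_of_ae_eq (μ := volume)
        (ae_mono (Measure.restrict_mono hUsub le_rfl) hae) hUo hc.continuousOn continuousOn_const
    -- On the diagonal the weight is 4 - 4 cos a, so this choice gives the value `t` exactly. For t
    -- = 0 or 8 the point is a corner of `U`, hence only membership in the closure is claimed;
    -- nearby points of `U` have sin p₁ > 0.
    set a := Real.arccos (1 - t / 4) with ha
    have hcosa : Real.cos a = 1 - t / 4 :=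
      Real.cos_arccos (by linarith [ht.2]) (by linarith [ht.1])
    have hacl : (a, a) ∈ closure U := by
      rw [hU, closure_prod_eq, closure_Ioo hpi.ne]
      exact ⟨⟨Real.arccos_nonneg _, Real.arccos_le_pi _⟩,
        ⟨Real.arccos_nonneg _, Real.arccos_le_pi _⟩⟩
    have hWo : IsOpen {p : ℝ × ℝ | |weight 1 p - t| < ε} :=
      isOpen_lt (by fun_prop) continuous_const
    have haW : (a, a) ∈ {p : ℝ × ℝ | |weight 1 p - t| < ε} := by
      have : weight 1 (a, a) - t = 0 := by
        simp only [weight, hcosa]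
        ring
      simpa [this] using hε
    obtain ⟨p, hpW, hpU⟩ := mem_closure_iff.1 hacl _ hWo haW
    have h1 : φ p = 0 := hzero hpU
    have h2 : 0 < Real.sin p.1 := Real.sin_pos_of_mem_Ioo hpU.1
    have h3 : 0 < 1 - |weight 1 p - t| / ε := sub_pos.2 ((div_lt_one hε).2 hpW)
    have h4 : 0 < φ p := mul_pos h2 (lt_max_of_lt_right h3)
    linarith
  · refine Lp.norm_le_mul_norm_of_ae_le_mul (f := ((freeHamiltonian (0, 0) -
      (t : ℂ) • (1 : oddL2 →L[ℂ] oddL2)) (oddVec φ hc hb ho) : Lp ℂ 2 torus)) ?_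
    have h1 := coeFn_freeHamiltonian (oddVec φ hc hb ho)
    have h2 := Lp.coeFn_smul (t : ℂ) (oddVec φ hc hb ho : Lp ℂ 2 torus)
    have h3 := Lp.coeFn_sub (freeHamiltonian (0, 0) (oddVec φ hc hb ho) : Lp ℂ 2 torus)
      ((t : ℂ) • (oddVec φ hc hb ho : Lp ℂ 2 torus))
    filter_upwards [h1, h2, h3, hcoe] with p e1 e2 e3 e4
    have e5 : ((freeHamiltonian (0, 0) - (t : ℂ) • (1 : oddL2 →L[ℂ] oddL2))
        (oddVec φ hc hb ho) : Lp ℂ 2 torus) p = ((weight 1 p - t : ℝ) : ℂ) * (φ p : ℂ) := by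
      refine e3.trans ?_
      rw [Pi.sub_apply, e1, e2, Pi.smul_apply, e4, smul_eq_mul, ← sub_mul, Complex.ofReal_sub]
    change _ ≤ ε * ‖(oddVec φ hc hb ho : Lp ℂ 2 torus) p‖
    rw [e5, e4, norm_mul, Complex.norm_real, Complex.norm_real, Real.norm_eq_abs]
    rcases le_or_gt |weight 1 p - t| ε with h | h
    · exact mul_le_mul_of_nonneg_right h (norm_nonneg _)
    · have : φ p = 0 := by
        simp only [hφ]
        rw [max_eq_left (sub_nonpos.2 ((one_le_div hε).2 h.le)), mul_zero]
      rw [this]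
      simp

/-- Off [0, 8] the operator is a finite rank perturbation of an invertible one. On [0, 8] the
Fredholm property would pass to the injective self-adjoint A - t and make it invertible, which
approximate eigenvectors exclude. -/
theorem essSpectrum_hamiltonian (lam mu : ℝ) :
    essSpectrum (hamiltonian lam mu (0, 0)) = ((↑) : ℝ → ℂ) '' Set.Icc 0 8 := by
  have hsplit : ∀ z : ℂ, hamiltonian lam mu (0, 0) - z • ContinuousLinearMap.id ℂ oddL2 =
      (freeHamiltonian (0, 0) - z • ContinuousLinearMap.id ℂ oddL2) + interaction lam mu :=
    fun z => by rw [hamiltonian]; abel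
  have hfin := hasFiniteRange_interaction lam mu
  ext z
  rw [essSpectrum, Set.mem_ofPred_eq, hsplit]
  constructor
  · intro h
    by_contra hz
    exact h (isFredholm_of_isUnit_add (isUnit_freeHamiltonian_sub hz) hfin)
  · rintro ⟨t, ht, rfl⟩ h
    have hunit : IsUnit (freeHamiltonian (0, 0) - (t : ℂ) • (1 : oddL2 →L[ℂ] oddL2)) :=
      isUnit_of_isFredholm_add (isSelfAdjoint_freeHamiltonian.sub (isSelfAdjoint_real_smul_one t))
        (freeHamiltonian_sub_injective t) hfin h
    obtain ⟨u, hu⟩ := hunit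
    set C := ‖(↑u⁻¹ : oddL2 →L[ℂ] oddL2)‖ with hC
    have hC0 : 0 ≤ C := norm_nonneg (↑u⁻¹ : oddL2 →L[ℂ] oddL2)
    -- This tolerance makes the product with the norm `C` of the inverse equal to C / (C + 1) < 1;
    -- adding 1 also covers C = 0.
    obtain ⟨f, hf0, hf⟩ := exists_approximate_eigenvector ht (ε := 1 / (C + 1)) (by positivity)
    rw [← hu] at hf
    have h1 : (↑u⁻¹ : oddL2 →L[ℂ] oddL2) ((u : oddL2 →L[ℂ] oddL2) f) = f := by
      rw [← mul_apply_eq_comp, Units.inv_mul, one_apply_eq_self]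
    have h2 := (↑u⁻¹ : oddL2 →L[ℂ] oddL2).le_opNorm ((u : oddL2 →L[ℂ] oddL2) f)
    rw [h1] at h2
    have h3 : ‖f‖ ≤ C * (1 / (C + 1) * ‖f‖) := h2.trans (mul_le_mul_of_nonneg_left hf hC0)
    have h4 : 0 < ‖f‖ := norm_pos_iff.2 hf0
    have h5 : C * (1 / (C + 1) * ‖f‖) = C / (C + 1) * ‖f‖ := by ring
    rw [h5] at h3
    have h6 : C / (C + 1) < 1 := (div_lt_one (by linarith)).2 (by linarith)
    nlinarith

theorem numBelow_hamiltonian (x : ℝ × ℝ) : numBelow (hamiltonian x.1 x.2 (0, 0)) =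
    Module.rank ℂ (lowerSpan (hamiltonian x.1 x.2 (0, 0)) 0) := by
  have h : {z : ℝ | ∀ w ∈ essSpectrum (hamiltonian x.1 x.2 (0, 0)), z < w.re} = {z | z < 0} := by
    rw [essSpectrum_hamiltonian]
    ext z
    constructor
    · intro hz
      simpa using hz 0 ⟨0, by norm_num, rfl⟩
    · rintro hz _ ⟨t, ht, rfl⟩
      exact lt_of_lt_of_le hz ht.1
  rw [numBelow, h, lowerSpan]

theorem numAbove_hamiltonian (x : ℝ × ℝ) : numAbove (hamiltonian x.1 x.2 (0, 0)) =
    Module.rank ℂ (lowerSpan ((8 : ℂ) • 1 - hamiltonian x.1 x.2 (0, 0)) 0) := by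
  have h : {z : ℝ | ∀ w ∈ essSpectrum (hamiltonian x.1 x.2 (0, 0)), w.re < z} = {z | 8 < z} := by
    rw [essSpectrum_hamiltonian]
    ext z
    constructor
    · intro hz
      simpa using hz 8 ⟨8, by norm_num, by norm_num⟩
    · rintro hz _ ⟨t, ht, rfl⟩
      exact lt_of_le_of_lt ht.2 hz
  rw [numAbove, h]
  refine congrArg (fun S : Submodule ℂ oddL2 => Module.rank ℂ S) (le_antisymm ?_ ?_)
  · refine iSup₂_le fun z hz f hf => ?_
    refine mem_lowerSpan_of_eigenvector (z := 8 - z) (sub_neg.2 hz) ?_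
    have hf' : hamiltonian x.1 x.2 (0, 0) f = (z : ℂ) • f := Module.End.mem_eigenspace_iff.1 hf
    change (8 : ℂ) • f - hamiltonian x.1 x.2 (0, 0) f = _
    rw [hf', ← sub_smul]
    push_cast
    rfl
  · refine iSup₂_le fun z hz f hf => ?_
    refine Submodule.mem_iSup_of_mem (8 - z) (Submodule.mem_iSup_of_mem ?_
      (Module.End.mem_eigenspace_iff.2 ?_))
    · change 8 < 8 - z
      have : z < 0 := hz
      linarith
    · have hf' : (8 : ℂ) • f - hamiltonian x.1 x.2 (0, 0) f = (z : ℂ) • f :=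
        Module.End.mem_eigenspace_iff.1 hf
      change hamiltonian x.1 x.2 (0, 0) f = _
      push_cast
      rw [sub_smul, ← hf']
      abel

/-- On a connected set on which `C⁻` does not vanish the number of negative eigenvalues of
`√A B √A` is constant. -/
theorem exists_rank_lowerSpan_eq {σ : ℝ} (hσ : σ = 1 ∨ σ = -1) {S : Set (ℝ × ℝ)}
    (hS : IsPreconnected S) (hne : S.Nonempty) (hC : ∀ x ∈ S, cMinus x.1 x.2 ≠ 0) :
    ∃ n : ℕ, ∀ x ∈ S,
      Module.rank ℂ (lowerSpan (sqrtOp hσ * birman hσ x * sqrtOp hσ) 0) = n := by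
  have hloc : ∀ x ∈ S, ∃ n : ℕ, ∀ᶠ y in nhds x,
      FiniteDimensional ℂ (lowerSpan (sqrtOp hσ * birman hσ y * sqrtOp hσ) 0) ∧
        Module.finrank ℂ (lowerSpan (sqrtOp hσ * birman hσ y * sqrtOp hσ) 0) = n := by
    intro x hx
    obtain ⟨n, δ, hδ, h⟩ := exists_finrank_lowerSpan_conj_eq (isSelfAdjoint_sqrtOp hσ)
      (sqrtOp_injective hσ) (isSelfAdjoint_birman hσ x) (hasFiniteRange_birman_sub_one hσ x)
      (birman_injective hσ (det_birmanMatrix hσ x ▸ hC x hx))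
    refine ⟨n, ?_⟩
    filter_upwards [continuous_coupling.continuousAt.eventually
      (eventually_norm_one_add_pairSum_sub_lt (resolvedVec hσ) (coupling x) hδ)] with y hy
    exact h _ (isSelfAdjoint_birman hσ y) (hasFiniteRange_birman_sub_one hσ y) hy
  -- A locally constant map into the discrete space ℕ is continuous, hence constant on a
  -- preconnected set.
  have hcont : ContinuousOn
      (fun y => Module.finrank ℂ (lowerSpan (sqrtOp hσ * birman hσ y * sqrtOp hσ) 0)) S := by
    intro x hx
    obtain ⟨n, hn⟩ := hloc x hx
    refine ContinuousAt.continuousWithinAt ?_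
    refine (continuousAt_const (y := n)).congr ?_
    filter_upwards [hn] with y hy
    exact hy.2.symm
  obtain ⟨x₀, hx₀⟩ := hne
  refine ⟨Module.finrank ℂ (lowerSpan (sqrtOp hσ * birman hσ x₀ * sqrtOp hσ) 0),
    fun x hx => ?_⟩
  obtain ⟨n, hn⟩ := hloc x hx
  have := hn.self_of_nhds.1
  rw [← Module.finrank_eq_rank]
  exact congrArg Nat.cast (hS.constant hcont hx hx₀)

theorem cMinus_ne_zero_of_mem {k : Fin 4} {x : ℝ × ℝ} (hx : x ∈ compMinus k) :
    cMinus x.1 x.2 ≠ 0 :=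
  cover_compMinus.ge (Set.mem_iUnion_of_mem k hx)

end Main
end TwoFermion

end

theorem mainTheorem2 :
    -- the essential spectrum of `H_{λμ}(0)` is `[0, 8]`
    (∀ lam mu : ℝ, TwoFermion.essSpectrum (TwoFermion.hamiltonian lam mu (0, 0)) =
      ((↑) : ℝ → ℂ) '' Set.Icc 0 8) ∧
    -- the sets `𝒞ₖ⁻` and `𝒞ₖ⁺` are the components cut out by the curves `C⁻ = 0` and `C⁺ = 0`
    TwoFermion.AreComponents {x : ℝ × ℝ | TwoFermion.cMinus x.1 x.2 ≠ 0} TwoFermion.compMinus ∧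
    TwoFermion.AreComponents {x : ℝ × ℝ | TwoFermion.cPlus x.1 x.2 ≠ 0} TwoFermion.compPlus ∧
    -- on each of them the respective number of eigenvalues is (finite and) constant
    (∀ k : Fin 4, ∃ n : ℕ, ∀ x ∈ TwoFermion.compMinus k,
      TwoFermion.numBelow (TwoFermion.hamiltonian x.1 x.2 (0, 0)) = n) ∧
    (∀ k : Fin 4, ∃ n : ℕ, ∀ x ∈ TwoFermion.compPlus k,
      TwoFermion.numAbove (TwoFermion.hamiltonian x.1 x.2 (0, 0)) = n) := by
  refine ⟨TwoFermion.essSpectrum_hamiltonian, TwoFermion.areComponents_compMinus,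
    TwoFermion.areComponents_compPlus, fun k => ?_, fun k => ?_⟩
  · obtain ⟨n, hn⟩ := TwoFermion.exists_rank_lowerSpan_eq (σ := 1) (Or.inl rfl)
      (TwoFermion.isPreconnected_compMinus k) (TwoFermion.nonempty_compMinus k)
      fun x hx => TwoFermion.cMinus_ne_zero_of_mem hx
    refine ⟨n, fun x hx => ?_⟩
    rw [TwoFermion.numBelow_hamiltonian, TwoFermion.hamiltonian_eq]
    exact hn x hx
  -- The count is carried out over `compMinus k` and evaluated at `-x`, because 8 - H is factorised
  -- with negated parameters.
  · obtain ⟨n, hn⟩ := TwoFermion.exists_rank_lowerSpan_eq (σ := -1) (Or.inr rfl)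
      (TwoFermion.isPreconnected_compMinus k) (TwoFermion.nonempty_compMinus k)
      fun x hx => TwoFermion.cMinus_ne_zero_of_mem hx
    refine ⟨n, fun x hx => ?_⟩
    rw [TwoFermion.numAbove_hamiltonian, TwoFermion.eight_sub_hamiltonian_eq]
    rw [TwoFermion.compPlus_eq_neg_preimage] at hx
    exact hn (-x) hx
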